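/- Let $\mathrm{AP}$ be a finite set of atomic propositions, $\Sigma = 2^{\mathrm{AP}}$, and call the elements of $\Sigma^\omega$ traces. A transition system $\mathcal T=(S,S_0,\kappa,L)$ has states $S$, initial states $S_0\subseteq S$, a transition relation $\kappa\subseteq S\times S$ and a labelling $L:S\to\Sigma$; $\mathit{Traces}(\mathcal T)$ is the set of all $L(s_0)L(s_1)L(s_2)\cdots$ with $s_0\in S_0$ and $(s_i,s_{i+1})\in\kappa$ for all $i$. Second-order HyperLTL formulas $\varphi$ are generated by $$\varphi ::= \mathbb Q\pi\in X.\,\varphi \mid \mathbb QX.\,\varphi\mid\psi,\qquad \psi ::= a_\pi\mid\neg\psi\mid\psi\wedge\psi\mid\bigcirc\psi\mid\psi\,\mathcal U\,\psi,$$ where $\mathbb Q\in\{\forall,\exists\}$, $a\in\mathrm{AP}$, $\pi$ is a trace variable and $X$ is a second-order variable (ranging over sets of traces); there are two special second-order variables $\mathfrak S$ and $\mathfrak A$. For a trace assignment $\Pi$ and an assignment $\Delta$ of sets of traces to second-order variables, quantifier-free formulas $\psi$ are evaluated in $\Pi$ by the LTL semantics, where $a_\pi$ holds iff $a\in\Pi(\pi)(0)$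 and all traces advance synchronously; $\Pi,\Delta\models\mathbb Q\pi\in X.\,\varphi$ iff $\mathbb Q t\in\Delta(X)$: $\Pi[\pi\mapsto t],\Delta\models\varphi$; and $\Pi,\Delta\models\mathbb QX.\,\varphi$ iff $\mathbb QA\subseteq\Sigma^\omega$: $\Pi,\Delta[X\mapsto A]\models\varphi$. For a closed formula $\varphi$ (no free variables except possibly $\mathfrak S$ and $\mathfrak A$), $\mathcal T\models\varphi$ means $\emptyset,[\mathfrak S\mapsto\mathit{Traces}(\mathcal T),\mathfrak A\mapsto\Sigma^\omega]\models\varphi$. **Proposition.** For each of the following five fragments, it is decidable, given a finite transition system $\mathcal T$ (together with its finite set $\mathrm{AP}$) and a closed formula $\varphi$ over $\mathrm{AP}$ in the fragment, whether $\mathcal T\models\varphi$. Here $\psi$ is quantifier-free, $n,m\ge 0$, and in (1)–(4) each $Y_j$ is any second-order variable (one of the $X_i$, or $\mathfrak S$, or $\mathfrak A$): 1. $\exists^*X\forall^*\pi$: formulas $\exists X_1\cdots\exists X_n.\,\forall\pi_1\in Y_1\cdots\forall\pi_m\in Y_m.\,\psi$; 2. $\forall^*X\forall^*\pi$: formulas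 $\forall X_1\cdots\forall X_n.\,\forall\pi_1\in Y_1\cdots\forall\pi_m\in Y_m.\,\psi$; 3. $\exists^*X\exists^*\pi$: formulas $\exists X_1\cdots\exists X_n.\,\exists\pi_1\in Y_1\cdots\exists\pi_m\in Y_m.\,\psi$; 4. $\forall^*X\exists^*\pi$: formulas $\forall X_1\cdots\forall X_n.\,\exists\pi_1\in Y_1\cdots\exists\pi_m\in Y_m.\,\psi$; 5. $\exists X.\,\exists^*\pi\in X\,\forall^*\pi'\in X$: formulas $\exists X.\,\exists\pi_1\in X\cdots\exists\pi_n\in X.\,\forall\pi'_1\in X\cdots\forall\pi'_m\in X.\,\psi$. -/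

import Mathlib

namespace SoHyperLTL

/-! Atomic propositions, trace variables and second-order variables are named by natural numbers.
The set of atomic propositions of a system is an arbitrary finite set `AP` of such names, and the
alphabet is the set of subsets of `AP`. -/

/-- An infinite word whose letters are finite sets of atomic propositions. -/
abbrev Trace : Type := ℕ → Finset ℕ

/-- The suffix `t[i, ∞]`. -/
def Trace.suffix (t : Trace) (i : ℕ) : Trace := fun j => t (i + j)

/-- The set of all traces over `AP`, i.e. of all infinite words over the alphabet `2 ^ AP`. -/
def allTraces (AP : Finset ℕ) : Set Trace := {t | ∀ i, t i ⊆ AP}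

/-! ### Transition systems -/

/-- A transition system over `AP` with state set `S`. -/
structure TransitionSystem (AP : Finset ℕ) (S : Type) where
  init : Set S
  trans : Set (S × S)
  label : S → Finset ℕ
  label_subset : ∀ s, label s ⊆ AP

/-- `ρ` is a path: an infinite sequence of states that starts in an initial state and follows the
transition relation. -/
def TransitionSystem.IsPath {AP : Finset ℕ} {S : Type} (T : TransitionSystem AP S)
    (ρ : ℕ → S) : Prop :=
  ρ 0 ∈ T.init ∧ ∀ i, (ρ i, ρ (i + 1)) ∈ T.trans

/-- The set of traces of a transition system. -/
def TransitionSystem.traces {AP : Finset ℕ} {S : Type} (T : TransitionSystem AP S) : Set Trace :=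
  {t | ∃ ρ : ℕ → S, T.IsPath ρ ∧ ∀ i, t i = T.label (ρ i)}

/-- A finite transition system, written down as a finite piece of data: its atomic propositions,
its number `n` of states (the states are `0, …, n - 1`), its initial states, its transitions
`(s, s')`, and the pairs `(s, a)` such that `a` is in the label of `s`. -/
structure FinSystem where
  props : List ℕ
  numStates : ℕ
  init : List ℕ
  trans : List (ℕ × ℕ)
  labels : List (ℕ × ℕ)

/-- The atomic propositions of a finite system. -/
def FinSystem.AP (M : FinSystem) : Finset ℕ := M.props.toFinset

/-- The transition system that the data describe. -/
def FinSystem.toTransitionSystem (M : FinSystem) :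
    TransitionSystem M.AP (Fin M.numStates) where
  init := {s | (s : ℕ) ∈ M.init}
  trans := {p | ((p.1 : ℕ), (p.2 : ℕ)) ∈ M.trans}
  label s := M.AP.filter fun a => ((s : ℕ), a) ∈ M.labels
  label_subset _ := Finset.filter_subset _ _

/-- Every transition system with finitely many states is described by such data, up to renaming
its states. -/
theorem FinSystem.exists_presentation {AP : Finset ℕ} {S : Type} [Finite S]
    (T : TransitionSystem AP S) :
    ∃ M : FinSystem, M.AP = AP ∧ ∃ e : S ≃ Fin M.numStates,
      (∀ s, e s ∈ M.toTransitionSystem.init ↔ s ∈ T.init) ∧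
      (∀ s s', (e s, e s') ∈ M.toTransitionSystem.trans ↔ (s, s') ∈ T.trans) ∧
      (∀ s, M.toTransitionSystem.label (e s) = T.label s) := by
  classical
  obtain ⟨n, ⟨e⟩⟩ := Finite.exists_equiv_fin S
  have : Fintype S := Fintype.ofFinite S
  refine ⟨⟨AP.toList, n,
    ((Finset.univ.filter fun s => s ∈ T.init).image fun s => (e s : ℕ)).toList,
    ((Finset.univ.filter fun p => p ∈ T.trans).image
      fun p : S × S => ((e p.1 : ℕ), (e p.2 : ℕ))).toList,
    (Finset.univ.biUnion fun s : S => (T.label s).image fun a => ((e s : ℕ), a)).toList⟩,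
    by simp [FinSystem.AP], e, ?_, ?_, ?_⟩
  · intro s
    simp [FinSystem.toTransitionSystem, Fin.val_inj]
  · intro s s'
    simp [FinSystem.toTransitionSystem, Fin.val_inj]
  · intro s
    ext a
    have h := @T.label_subset s a
    simp [FinSystem.toTransitionSystem, FinSystem.AP, Fin.val_inj]
    tauto

/-! ### Syntax -/

/-- Quantifier-free formulas: `atom a π` is `a_π`. -/
inductive Body : Type
  | atom (a π : ℕ)
  | neg (ψ : Body)
  | conj (ψ χ : Body)
  | nextOp (ψ : Body)
  | untilOp (ψ χ : Body)

/-- The two quantifiers. -/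
inductive Quant : Type
  | all
  | ex

/-- The second-order variable that denotes the set of traces of the system. -/
def sysVar : ℕ := 0

/-- The second-order variable that denotes the set of all traces. -/
def allVar : ℕ := 1

/-- One quantification in a formula: `trace Q π X` is `Q π ∈ X`, and `set Q X` is `Q X`. -/
inductive Quantification : Type
  | trace (Q : Quant) (π X : ℕ)
  | set (Q : Quant) (X : ℕ)

/-- A second-order HyperLTL formula: a sequence of first-order and second-order quantifications,
followed by a quantifier-free formula. -/
structure Formula where
  quants : List Quantification
  body : Body

/-! ### Semantics -/

/-- Partial assignments of traces to trace variables. -/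
abbrev TraceAssignment : Type := ℕ → Option Trace

/-- Partial assignments of sets of traces to second-order variables. -/
abbrev SetAssignment : Type := ℕ → Option (Set Trace)

/-- The assignment `Π[i, ∞]`. -/
def TraceAssignment.suffix (A : TraceAssignment) (i : ℕ) : TraceAssignment :=
  fun π => (A π).map fun t => t.suffix i

/-- `A ⊨ ψ`. -/
def Body.Holds : Body → TraceAssignment → Prop
  | .atom a π, A => ∃ t, A π = some t ∧ a ∈ t 0
  | .neg ψ, A => ¬ ψ.Holds A
  | .conj ψ χ, A => ψ.Holds A ∧ χ.Holds A
  | .nextOp ψ, A => ψ.Holds (A.suffix 1)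
  | .untilOp ψ χ, A => ∃ i, χ.Holds (A.suffix i) ∧ ∀ j < i, ψ.Holds (A.suffix j)

/-- Quantification over the elements of a set. -/
def Quant.Over {α : Type} (Q : Quant) (s : Set α) (P : α → Prop) : Prop :=
  match Q with
  | .all => ∀ x ∈ s, P x
  | .ex => ∃ x ∈ s, P x

/-- Satisfaction of the formula with the given quantifications and body; second-order
quantification ranges over all subsets of the set of all traces over `AP`. (A second-order
variable that has no value, which cannot be met in a closed formula, is read as `∅`.) -/
def Holds (AP : Finset ℕ) (ψ : Body) :
    List Quantification → TraceAssignment → SetAssignment → Prop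
  | [], A, _ => ψ.Holds A
  | .trace Q π X :: qs, A, D =>
      Q.Over ((D X).getD ∅) fun t => Holds AP ψ qs (Function.update A π (some t)) D
  | .set Q X :: qs, A, D =>
      Q.Over {U : Set Trace | U ⊆ allTraces AP} fun U =>
        Holds AP ψ qs A (Function.update D X (some U))

/-- The initial second-order assignment. -/
def initialSets (AP : Finset ℕ) (sysTraces : Set Trace) : SetAssignment :=
  Function.update (Function.update (fun _ => none) sysVar (some sysTraces))
    allVar (some (allTraces AP))

/-- `T ⊨ φ`. -/
def TransitionSystem.Satisfies {AP : Finset ℕ} {S : Type} (T : TransitionSystem AP S)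
    (φ : Formula) : Prop :=
  Holds AP φ.body φ.quants (fun _ => none) (initialSets AP T.traces)

/-! ### Closed formulas over a set of atomic propositions -/

/-- All atomic propositions of `ψ` are in `AP`, and all its trace variables are in `V`. -/
def Body.WellFormed (AP V : Finset ℕ) : Body → Prop
  | .atom a π => a ∈ AP ∧ π ∈ V
  | .neg ψ => ψ.WellFormed AP V
  | .conj ψ χ => ψ.WellFormed AP V ∧ χ.WellFormed AP V
  | .nextOp ψ => ψ.WellFormed AP V
  | .untilOp ψ χ => ψ.WellFormed AP V ∧ χ.WellFormed AP V

/-- Well-formedness when the trace variables in `V` and the second-order variables in `W` are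
already bound. -/
def WellFormedIn (AP : Finset ℕ) (ψ : Body) :
    List Quantification → Finset ℕ → Finset ℕ → Prop
  | [], V, _ => ψ.WellFormed AP V
  | .trace _ π X :: qs, V, W => X ∈ W ∧ WellFormedIn AP ψ qs (insert π V) W
  | .set _ X :: qs, V, W => WellFormedIn AP ψ qs V (insert X W)

/-- `φ` is a formula over `AP` whose only free variables are the two special second-order
variables. -/
def Formula.WellFormed (AP : Finset ℕ) (φ : Formula) : Prop :=
  WellFormedIn AP φ.body φ.quants ∅ {sysVar, allVar}

/-! ### Encodings -/

/-- The code of a quantifier-free formula. -/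
def Body.code : Body → ℕ
  | .atom a π => 5 * Nat.pair a π
  | .neg ψ => 5 * ψ.code + 1
  | .nextOp ψ => 5 * ψ.code + 2
  | .conj ψ χ => 5 * Nat.pair ψ.code χ.code + 3
  | .untilOp ψ χ => 5 * Nat.pair ψ.code χ.code + 4

/-- The quantifier-free formula with a given code. -/
def Body.ofCode (n : ℕ) : Body :=
  if h : n % 5 = 0 then .atom (n / 5).unpair.1 (n / 5).unpair.2
  else
    have h0 : n / 5 < n := Nat.div_lt_self (Nat.pos_of_ne_zero (by rintro rfl; simp at h))
      (by norm_num)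
    have h1 : (n / 5).unpair.1 < n := lt_of_le_of_lt (Nat.unpair_left_le _) h0
    have h2 : (n / 5).unpair.2 < n := lt_of_le_of_lt (Nat.unpair_right_le _) h0
    if n % 5 = 1 then .neg (Body.ofCode (n / 5))
    else if n % 5 = 2 then .nextOp (Body.ofCode (n / 5))
    else if n % 5 = 3 then
      .conj (Body.ofCode (n / 5).unpair.1) (Body.ofCode (n / 5).unpair.2)
    else .untilOp (Body.ofCode (n / 5).unpair.1) (Body.ofCode (n / 5).unpair.2)
termination_by n

theorem Body.ofCode_code (ψ : Body) : Body.ofCode ψ.code = ψ := by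
  induction ψ with
  | atom a π => rw [Body.ofCode]; simp [Body.code]
  | neg ψ ih =>
    have e : (5 * ψ.code + 1) / 5 = ψ.code := by omega
    rw [Body.ofCode]; simp [Body.code, Nat.add_mod, e, ih]
  | nextOp ψ ih =>
    have e : (5 * ψ.code + 2) / 5 = ψ.code := by omega
    rw [Body.ofCode]; simp [Body.code, Nat.add_mod, e, ih]
  | conj ψ χ ih ih' =>
    have e : (5 * Nat.pair ψ.code χ.code + 3) / 5 = Nat.pair ψ.code χ.code := by omega
    rw [Body.ofCode]; simp [Body.code, Nat.add_mod, e, ih, ih']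
  | untilOp ψ χ ih ih' =>
    have e : (5 * Nat.pair ψ.code χ.code + 4) / 5 = Nat.pair ψ.code χ.code := by omega
    rw [Body.ofCode]; simp [Body.code, Nat.add_mod, e, ih, ih']

theorem Body.code_ofCode (n : ℕ) : (Body.ofCode n).code = n := by
  induction n using Nat.strong_induction_on with
  | _ n ih =>
    rw [Body.ofCode]
    by_cases h : n % 5 = 0
    · simp only [h, dite_true, Body.code, Nat.pair_unpair]
      omega
    · have h0 : n / 5 < n := by omega
      have i0 := ih _ h0
      have i1 := ih _ (lt_of_le_of_lt (Nat.unpair_left_le (n / 5)) h0)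
      have i2 := ih _ (lt_of_le_of_lt (Nat.unpair_right_le (n / 5)) h0)
      simp only [h, dite_false]
      split_ifs <;> simp only [Body.code, i0, i1, i2, Nat.pair_unpair] <;> omega

instance : Denumerable Body :=
  Denumerable.mk' ⟨Body.code, Body.ofCode, Body.ofCode_code, Body.code_ofCode⟩

/-- Quantifiers as Booleans. -/
def Quant.equivBool : Quant ≃ Bool where
  toFun Q := match Q with
    | .all => false
    | .ex => true
  invFun b := match b with
    | false => .all
    | true => .ex
  left_inv Q := by cases Q <;> rfl
  right_inv b := by cases b <;> rfl

instance : Primcodable Quant := Primcodable.ofEquiv Bool Quant.equivBool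

/-- Quantifications as tuples. -/
def Quantification.equivSum : Quantification ≃ (Quant × ℕ × ℕ) ⊕ (Quant × ℕ) where
  toFun q := match q with
    | .trace Q π X => .inl (Q, π, X)
    | .set Q X => .inr (Q, X)
  invFun s := match s with
    | .inl (Q, π, X) => .trace Q π X
    | .inr (Q, X) => .set Q X
  left_inv q := by cases q <;> rfl
  right_inv s := by rcases s with ⟨Q, π, X⟩ | ⟨Q, X⟩ <;> rfl

instance : Primcodable Quantification :=
  Primcodable.ofEquiv ((Quant × ℕ × ℕ) ⊕ (Quant × ℕ)) Quantification.equivSum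

/-- Formulas as pairs. -/
def Formula.equivProd : Formula ≃ List Quantification × Body where
  toFun φ := (φ.quants, φ.body)
  invFun p := ⟨p.1, p.2⟩
  left_inv _ := rfl
  right_inv _ := rfl

instance : Primcodable Formula :=
  Primcodable.ofEquiv (List Quantification × Body) Formula.equivProd

/-- Finite systems as tuples. -/
def FinSystem.equivProd :
    FinSystem ≃ List ℕ × ℕ × List ℕ × List (ℕ × ℕ) × List (ℕ × ℕ) where
  toFun M := (M.props, M.numStates, M.init, M.trans, M.labels)
  invFun p := ⟨p.1, p.2.1, p.2.2.1, p.2.2.2.1, p.2.2.2.2⟩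
  left_inv _ := rfl
  right_inv _ := rfl

instance : Primcodable FinSystem :=
  Primcodable.ofEquiv (List ℕ × ℕ × List ℕ × List (ℕ × ℕ) × List (ℕ × ℕ)) FinSystem.equivProd

/-! ### Fragments and decidability -/

/-- The fragment `Q₁* X Q₂* π`: finitely many (possibly no) second-order `Q₁`-quantifications,
then finitely many first-order `Q₂`-quantifications, over any second-order variables, then a
quantifier-free formula. -/
def Fragment (Q₁ Q₂ : Quant) (φ : Formula) : Prop :=
  ∃ (Xs : List ℕ) (ps : List (ℕ × ℕ)),
    φ.quants = Xs.map (fun X => .set Q₁ X) ++ ps.map (fun p => .trace Q₂ p.1 p.2)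

/-- The fragment `∃ X. ∃* π ∈ X ∀* π' ∈ X`: all first-order quantifications are over `X`. -/
def SingleSetFragment (φ : Formula) : Prop :=
  ∃ (X : ℕ) (πs πs' : List ℕ),
    φ.quants = .set .ex X ::
      (πs.map (fun π => .trace .ex π X) ++ πs'.map (fun π => .trace .all π X))

/-- The model-checking problem for the formulas in `F` is decidable: there is an algorithm which,
given a finite transition system and a formula, decides whether the formula is a closed formula
over the atomic propositions of the system, is in `F`, and is satisfied by the system. -/
def ModelCheckingDecidable (F : Formula → Prop) : Prop :=
  ComputablePred fun x : FinSystem × Formula =>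
    F x.2 ∧ x.2.WellFormed x.1.AP ∧ x.1.toTransitionSystem.Satisfies x.2

end SoHyperLTL

/-! In the first four fragments all first-order quantifiers agree, so truth is monotone in the sets
(existential traces) or antitone (universal traces). Each second-order quantifier therefore has an
extremal choice, either the empty set or the set of all traces: the best one for `∃X`, the worst one
for `∀X`. Fixing that choice (`holds_ex_ex`, `holds_all_ex`, `holds_ex_all`, `holds_all_all`)
removes the set quantifiers. Universal traces become existential ones by negating the body. What is
left asks for finitely many traces, some of them traces of the system, that satisfy an LTL formula.
With the choice `∅`, existential traces moreover must not range over a quantified set.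

In the fifth fragment, `X` may be shrunk to the set of the existential witnesses. The universal
traces then range over finitely many named traces, so the body has to hold under finitely many
readings of its trace variables by the witnesses (`holds_singleSet_iff`).

Both questions are instances of `JointlySatisfiable`: traces are sought that make one LTL formula
true under finitely many readings at once. The usual tableau turns this into a fair run of a finite
graph: a state records which formulas, atoms and system states are true at the moment, steps follow
the expansion laws, and each until gives one fairness condition (`jointlySatisfiable_iff`). A fair
run exists iff some set of states is a fair core (`hasFairRun_iff`).

Formulas, states and sets of states are all coded by numbers, sets by their bits. Every criterion
thus becomes an arithmetic condition with bounded quantifiers, and all the predicates are even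
primitive recursive. -/

namespace SoHyperLTL

/-! ### Closure properties of primitive recursive functions and predicates -/

section PrimrecToolkit

variable {α β σ : Type*} [Primcodable α] [Primcodable β] [Primcodable σ]

attribute [fun_prop] Primrec
attribute [fun_prop] Primrec.id Primrec.const Primrec.comp

@[fun_prop]
theorem primrec_id' : Primrec fun a : α => a := Primrec.id

@[fun_prop]
theorem primrec_fst {f : α → β × σ} (hf : Primrec f) : Primrec fun a => (f a).1 :=
  Primrec.fst.comp hf

@[fun_prop]
theorem primrec_snd {f : α → β × σ} (hf : Primrec f) : Primrec fun a => (f a).2 :=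
  Primrec.snd.comp hf

@[fun_prop]
theorem primrec_mk {f : α → β} {g : α → σ} (hf : Primrec f) (hg : Primrec g) :
    Primrec fun a => (f a, g a) := hf.pair hg

@[fun_prop]
theorem primrec_pair {f g : α → ℕ} (hf : Primrec f) (hg : Primrec g) :
    Primrec fun a => Nat.pair (f a) (g a) := Primrec₂.natPair.comp hf hg

@[fun_prop]
theorem primrec_unpair {f : α → ℕ} (hf : Primrec f) : Primrec fun a => Nat.unpair (f a) :=
  Primrec.unpair.comp hf

@[fun_prop]
theorem primrec_add {f g : α → ℕ} (hf : Primrec f) (hg : Primrec g) :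
    Primrec fun a => f a + g a := Primrec.nat_add.comp hf hg

@[fun_prop]
theorem primrec_mul {f g : α → ℕ} (hf : Primrec f) (hg : Primrec g) :
    Primrec fun a => f a * g a := Primrec.nat_mul.comp hf hg

@[fun_prop]
theorem primrec_div {f g : α → ℕ} (hf : Primrec f) (hg : Primrec g) :
    Primrec fun a => f a / g a := Primrec.nat_div.comp hf hg

@[fun_prop]
theorem primrec_mod {f g : α → ℕ} (hf : Primrec f) (hg : Primrec g) :
    Primrec fun a => f a % g a := Primrec.nat_mod.comp hf hg

@[fun_prop]
theorem primrec_pow {f g : α → ℕ} (hf : Primrec f) (hg : Primrec g) :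
    Primrec fun a => f a ^ g a :=
  (Primrec₂.unpaired'.1 Nat.Primrec.pow : Primrec₂ fun m n : ℕ => m ^ n).comp hf hg

theorem primrecPred_and {p q : α → Prop} (hp : PrimrecPred p) (hq : PrimrecPred q) :
    PrimrecPred fun a => p a ∧ q a := hp.and hq

theorem primrecPred_or {p q : α → Prop} (hp : PrimrecPred p) (hq : PrimrecPred q) :
    PrimrecPred fun a => p a ∨ q a := hp.or hq

theorem primrecPred_not {p : α → Prop} (hp : PrimrecPred p) :
    PrimrecPred fun a => ¬ p a := hp.not

theorem primrecPred_imp {p q : α → Prop} (hp : PrimrecPred p) (hq : PrimrecPred q) :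
    PrimrecPred fun a => p a → q a :=
  (hp.not.or hq).of_eq fun _ => imp_iff_not_or.symm

theorem primrecPred_iff {p q : α → Prop} (hp : PrimrecPred p) (hq : PrimrecPred q) :
    PrimrecPred fun a => p a ↔ q a :=
  ((primrecPred_imp hp hq).and (primrecPred_imp hq hp)).of_eq fun _ => iff_def.symm

theorem primrecPred_eq {f g : α → ℕ} (hf : Primrec f) (hg : Primrec g) :
    PrimrecPred fun a => f a = g a := Primrec.eq.comp hf hg

theorem primrecPred_lt {f g : α → ℕ} (hf : Primrec f) (hg : Primrec g) :
    PrimrecPred fun a => f a < g a := Primrec.nat_lt.comp hf hg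

theorem primrecPred_le {f g : α → ℕ} (hf : Primrec f) (hg : Primrec g) :
    PrimrecPred fun a => f a ≤ g a := Primrec.nat_le.comp hf hg

/-- The bound may depend on the input, even exponentially. This is why the criteria below are all
phrased with bounded numerical quantifiers. -/
theorem primrecPred_exists_lt {b : α → ℕ} {p : α → ℕ → Prop} (hb : Primrec b)
    (hp : PrimrecPred fun x : α × ℕ => p x.1 x.2) : PrimrecPred fun a => ∃ n < b a, p a n := by
  have h : PrimrecRel fun (n : ℕ) (a : α) => p a n := hp.comp (Primrec.snd.pair Primrec.fst)
  exact (h.exists_mem_list.comp (Primrec.list_range.comp hb) Primrec.id).of_eq (by simp)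

theorem primrecPred_forall_lt {b : α → ℕ} {p : α → ℕ → Prop} (hb : Primrec b)
    (hp : PrimrecPred fun x : α × ℕ => p x.1 x.2) : PrimrecPred fun a => ∀ n < b a, p a n := by
  have h : PrimrecRel fun (n : ℕ) (a : α) => p a n := hp.comp (Primrec.snd.pair Primrec.fst)
  exact (h.forall_mem_list.comp (Primrec.list_range.comp hb) Primrec.id).of_eq (by simp)

theorem primrecPred_testBit {f g : α → ℕ} (hf : Primrec f) (hg : Primrec g) :
    PrimrecPred fun a => (f a).testBit (g a) = true := by
  have h : PrimrecPred fun a => f a / 2 ^ g a % 2 = 1 := primrecPred_eq (by fun_prop) (by fun_prop)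
  exact h.of_eq fun a => by simp [Nat.testBit_eq_decide_div_mod_eq]

theorem primrecPred_mem [DecidableEq β] {f : α → β} {l : α → List β} (hf : Primrec f)
    (hl : Primrec l) : PrimrecPred fun a => f a ∈ l a := by
  have h : PrimrecRel fun (l : List β) (b : β) => ∃ a ∈ l, a = b :=
    PrimrecRel.exists_mem_list (R := fun a b : β => a = b) Primrec.eq
  exact (h.comp hl hf).of_eq fun a => by simp

theorem primrecPred_mem_pair {f g : α → ℕ} {l : α → List (ℕ × ℕ)} (hf : Primrec f)
    (hg : Primrec g) (hl : Primrec l) : PrimrecPred fun a => (f a, g a) ∈ l a :=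
  primrecPred_mem (hf.pair hg) hl

end PrimrecToolkit

/-! ### Runs with a generalised Büchi condition -/

section FairRuns

/-- There is an infinite run through the states below `B` that starts in `I`, follows `R`, and
visits each of the sets `G 0, …, G (K - 1)` infinitely often. -/
def HasFairRun (B K : ℕ) (I : ℕ → Prop) (R G : ℕ → ℕ → Prop) : Prop :=
  ∃ v : ℕ → ℕ, (∀ i, v i < B) ∧ I (v 0) ∧ (∀ i, R (v i) (v (i + 1))) ∧
    ∀ k < K, ∀ i, ∃ j ≥ i, G k (v j)

/-- The set of states coded by the bits of `C` meets `I`, has no dead ends, and contains no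
nonempty set that avoids some `G k` and cannot be left inside `C`. -/
def IsFairCore (B K : ℕ) (I : ℕ → Prop) (R G : ℕ → ℕ → Prop) (C : ℕ) : Prop :=
  (∃ v < B, C.testBit v = true ∧ I v) ∧
  (∀ v < B, C.testBit v = true → ∃ w < B, C.testBit w = true ∧ R v w) ∧
  ∀ k < K, ∀ D < 2 ^ B, (∃ v < B, D.testBit v = true) →
    (∀ v < B, D.testBit v = true → C.testBit v = true ∧ ¬ G k v) →
    ∃ v < B, ∃ w < B, D.testBit v = true ∧ C.testBit w = true ∧ ¬ D.testBit w = true ∧ R v w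

/-- Replaces a quantifier over subsets of `{0, …, E - 1}` by one over numbers below `2 ^ E`. -/
theorem exists_lt_two_pow_testBit (P : ℕ → Prop) (E : ℕ) :
    ∃ v < 2 ^ E, ∀ e < E, v.testBit e = true ↔ P e := by
  classical
  refine ⟨Nat.ofBits fun i : Fin E => decide (P i), Nat.ofBits_lt_two_pow _, fun e he => ?_⟩
  rw [Nat.testBit_ofBits_lt _ _ he]
  simp

/-- A state space without dead ends in which each `G k` can be reached from everywhere has a run
that visits all of them infinitely often. -/
theorem exists_fair_path {S : Set ℕ} {R G : ℕ → ℕ → Prop} (hS : ∀ v ∈ S, ∃ w ∈ S, R v w)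
    (rank : ℕ → ℕ → ℕ)
    (hrank : ∀ k, ∀ v ∈ S, ¬ G k v → ∃ w ∈ S, R v w ∧ rank k w < rank k v)
    {v₀ : ℕ} (hv₀ : v₀ ∈ S) :
    ∃ v : ℕ → ℕ, v 0 = v₀ ∧ (∀ i, v i ∈ S) ∧ (∀ i, R (v i) (v (i + 1))) ∧
      ∀ k i, ∃ j ≥ i, G k (v j) := by
  classical
  -- The second component is a stage `n`, with target `G n.unpair.1`, so that each `k` is the target
  -- at infinitely many stages. The stage advances when its target is met; otherwise the rank
  -- decreases.
  have step : ∀ p : S × ℕ, ∃ q : S × ℕ, R p.1 q.1 ∧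
      (G p.2.unpair.1 p.1 → q.2 = p.2 + 1) ∧
      (¬ G p.2.unpair.1 p.1 →
        q.2 = p.2 ∧ rank p.2.unpair.1 q.1 < rank p.2.unpair.1 p.1) := by
    rintro ⟨⟨v, hv⟩, n⟩
    by_cases h : G n.unpair.1 v
    · obtain ⟨w, hw, hR⟩ := hS v hv
      exact ⟨(⟨w, hw⟩, n + 1), hR, fun _ => rfl, fun h' => absurd h h'⟩
    · obtain ⟨w, hw, hR, hr⟩ := hrank _ v hv h
      exact ⟨(⟨w, hw⟩, n), hR, fun h' => absurd h' h, fun _ => ⟨rfl, hr⟩⟩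
  choose next hR hG hN using step
  let s : ℕ → S × ℕ := fun i => next^[i] (⟨v₀, hv₀⟩, 0)
  have hs : ∀ i, s (i + 1) = next (s i) := fun i => Function.iterate_succ_apply' _ _ _
  have hit : ∀ r i n, (s i).2 = n → rank n.unpair.1 (s i).1 = r →
      ∃ j, (s j).2 = n ∧ G n.unpair.1 (s j).1 := by
    intro r
    induction r using Nat.strong_induction_on with
    | _ r ih =>
      intro i n hn hr
      by_cases h : G n.unpair.1 (s i).1
      · exact ⟨i, hn, h⟩
      · obtain ⟨h1, h2⟩ := hN (s i) (by rwa [hn])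
        rw [← hs, hn] at h1 h2
        exact ih _ (hr ▸ h2) (i + 1) n h1 rfl
  have reach : ∀ n, ∃ i, (s i).2 = n := by
    intro n
    induction n with
    | zero => exact ⟨0, rfl⟩
    | succ n ih =>
      obtain ⟨i, hi⟩ := ih
      obtain ⟨j, hj, hGj⟩ := hit _ i n hi rfl
      exact ⟨j + 1, by rw [hs, hG _ (by rwa [hj]), hj]⟩
  -- The stage grows by at most one per step, so stage `Nat.pair k i ≥ i` occurs only at times `≥
  -- i`.
  have le : ∀ i, (s i).2 ≤ i := by
    intro i
    induction i with
    | zero => exact le_rfl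
    | succ i ih =>
      rw [hs]
      by_cases h : G (s i).2.unpair.1 (s i).1
      · rw [hG _ h]; omega
      · rw [(hN _ h).1]; omega
  refine ⟨fun i => (s i).1, rfl, fun i => (s i).1.2, fun i => ?_, fun k i => ?_⟩
  · simp only [hs]; exact hR _
  · obtain ⟨i', hi'⟩ := reach (Nat.pair k i)
    obtain ⟨j, hj, hGj⟩ := hit _ i' _ hi' rfl
    refine ⟨j, ?_, by simpa using hGj⟩
    have := le j
    have := Nat.right_le_pair k i
    omega

/-- The states visited by a fair run form a core: a set that avoids `G k` and could not be left
would trap the run. Conversely, the states of a core from which `G k` cannot be reached inside the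
core would form such a trap, so every target is always reachable. -/
theorem hasFairRun_iff (B K : ℕ) (I : ℕ → Prop) (R G : ℕ → ℕ → Prop) :
    HasFairRun B K I R G ↔ ∃ C < 2 ^ B, IsFairCore B K I R G C := by
  classical
  constructor
  · rintro ⟨v, hB, hI, hR, hG⟩
    obtain ⟨C, hC, hmem⟩ := exists_lt_two_pow_testBit (fun e => ∃ i, v i = e) B
    have hvC : ∀ i, C.testBit (v i) = true := fun i => (hmem _ (hB i)).2 ⟨i, rfl⟩
    refine ⟨C, hC, ⟨v 0, hB 0, hvC 0, hI⟩, ?_, ?_⟩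
    · intro x hx hxC
      obtain ⟨i, rfl⟩ := (hmem x hx).1 hxC
      exact ⟨_, hB (i + 1), hvC _, hR i⟩
    · rintro k hk D - ⟨x, hx, hxD⟩ hD
      obtain ⟨i, rfl⟩ := (hmem x hx).1 (hD x hx hxD).1
      obtain ⟨j, hj, hGj⟩ := hG k hk i
      have hjD : ¬ D.testBit (v j) = true := fun h => (hD _ (hB j) h).2 hGj
      by_contra hcon
      push Not at hcon
      have : ∀ m, D.testBit (v (i + m)) = true := by
        intro m
        induction m with
        | zero => exact hxD
        | succ m ih =>
          by_contra h
          exact hcon _ (hB (i + m)) _ (hB (i + m + 1)) ih (hvC _) h (hR _)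
      apply hjD
      have := this (j - i)
      rwa [Nat.add_sub_cancel' hj] at this
  · rintro ⟨C, -, ⟨v₀, hv₀, hv₀C, hI⟩, hstep, hfair⟩
    let S : Set ℕ := {v | v < B ∧ C.testBit v = true}
    -- Only the first `n` steps of `p` have to follow `R`. For `k ≥ K` the target is void, since
    -- `exists_fair_path` wants a target for every `k`.
    let Path : ℕ → ℕ → ℕ → Prop := fun k n v =>
      ∃ p : ℕ → ℕ, p 0 = v ∧ (∀ i, p i ∈ S) ∧ (∀ i < n, R (p i) (p (i + 1))) ∧
        (k < K → G k (p n))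
    have hS : ∀ v ∈ S, ∃ w ∈ S, R v w := by
      rintro v ⟨hv, hvC⟩
      obtain ⟨w, hw, hwC, hR⟩ := hstep v hv hvC
      exact ⟨w, ⟨hw, hwC⟩, hR⟩
    have cons : ∀ k n v w, v ∈ S → R v w → Path k n w → Path k (n + 1) v := by
      rintro k n v w hv hR ⟨p, rfl, hpS, hpR, hpG⟩
      refine ⟨fun i => Nat.casesOn i v p, rfl, ?_, ?_, hpG⟩
      · rintro (_ | i)
        · exact hv
        · exact hpS i
      · rintro (_ | i) hi
        · exact hR
        · exact hpR i (by omega)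
    have hPath : ∀ k, ∀ v ∈ S, ∃ n, Path k n v := by
      intro k v hv
      by_cases hk : k < K
      · by_contra hno
        -- `D` collects the states of the core that cannot reach `G k`; the edge that leaves `D`
        -- leads to a state that can, a contradiction.
        obtain ⟨D, hDB, hD⟩ := exists_lt_two_pow_testBit (fun e => e ∈ S ∧ ¬ ∃ n, Path k n e) B
        obtain ⟨x, hx, y, hy, hxD, hyC, hyD, hR⟩ := hfair k hk D hDB
          ⟨v, hv.1, (hD v hv.1).2 ⟨hv, hno⟩⟩ (fun x hx hxD => by
            obtain ⟨h1, h2⟩ := (hD x hx).1 hxD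
            exact ⟨h1.2, fun hG => h2 ⟨0, fun _ => x, rfl, fun _ => h1, by simp, fun _ => hG⟩⟩)
        obtain ⟨h1, h2⟩ := (hD x hx).1 hxD
        rw [hD y hy] at hyD
        push Not at hyD
        obtain ⟨n, hn⟩ := hyD ⟨hy, hyC⟩
        exact h2 ⟨n + 1, cons k n x y h1 hR hn⟩
      · exact ⟨0, fun _ => v, rfl, fun _ => hv, by simp, fun h => absurd h hk⟩
    obtain ⟨v, hv0, hvS, hvR, hvG⟩ := exists_fair_path (G := fun k v => k < K → G k v) hS
      -- The rank is the distance to the target, which drops along a shortest path.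
      (fun k v => sInf {n | Path k n v}) (by
        intro k v hv hG
        have hmin : Path k (sInf {n | Path k n v}) v := Nat.sInf_mem (hPath k v hv)
        rcases hn : sInf {n | Path k n v} with _ | n <;> rw [hn] at hmin <;>
          obtain ⟨p, hp0, hpS, hpR, hpG⟩ := hmin
        · rw [hp0] at hpG
          exact absurd hpG hG
        · refine ⟨p 1, hpS 1, hp0 ▸ hpR 0 (by omega), Nat.lt_succ_of_le (Nat.sInf_le ?_)⟩
          exact ⟨fun i => p (i + 1), rfl, fun i => hpS _, fun i hi => hpR _ (by omega), hpG⟩)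
      (show v₀ ∈ S from ⟨hv₀, hv₀C⟩)
    exact ⟨v, fun i => (hvS i).1, hv0 ▸ hI, hvR, fun k hk i => by
      obtain ⟨j, hj, hG⟩ := hvG k i
      exact ⟨j, hj, hG hk⟩⟩

theorem primrecPred_hasFairRun {α : Type} [Primcodable α] {B K : α → ℕ} {I : α → ℕ → Prop}
    {R G : α → ℕ → ℕ → Prop} (hB : Primrec B) (hK : Primrec K)
    (hI : PrimrecPred fun x : α × ℕ => I x.1 x.2)
    (hR : PrimrecPred fun x : α × ℕ × ℕ => R x.1 x.2.1 x.2.2)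
    (hG : PrimrecPred fun x : α × ℕ × ℕ => G x.1 x.2.1 x.2.2) :
    PrimrecPred fun a => HasFairRun (B a) (K a) (I a) (R a) (G a) := by
  have hI' : ∀ {β : Type} [Primcodable β] {f : β → α} {g : β → ℕ}, Primrec f → Primrec g →
      PrimrecPred fun b => I (f b) (g b) := fun hf hg => hI.comp (hf.pair hg)
  have hR' : ∀ {β : Type} [Primcodable β] {f : β → α} {g h : β → ℕ}, Primrec f → Primrec g →
      Primrec h → PrimrecPred fun b => R (f b) (g b) (h b) :=
    fun hf hg hh => hR.comp (hf.pair (hg.pair hh))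
  have hG' : ∀ {β : Type} [Primcodable β] {f : β → α} {g h : β → ℕ}, Primrec f → Primrec g →
      Primrec h → PrimrecPred fun b => G (f b) (g b) (h b) :=
    fun hf hg hh => hG.comp (hf.pair (hg.pair hh))
  simp only [hasFairRun_iff, IsFairCore]
  repeat' first
    | with_reducible apply primrecPred_exists_lt
    | with_reducible apply primrecPred_forall_lt
    | with_reducible apply primrecPred_and
    | with_reducible apply primrecPred_not
    | with_reducible apply primrecPred_testBit
    | with_reducible apply hI'
    | with_reducible apply hR'
    | with_reducible apply hG'
    | with_reducible apply primrecPred_imp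
    | fun_prop

end FairRuns

/-! ### The tableau for joint satisfiability -/

section JointSatisfiability

theorem Body.ofCode_atom {c : ℕ} (h : c % 5 = 0) :
    Body.ofCode c = .atom (c / 5).unpair.1 (c / 5).unpair.2 := by
  rw [Body.ofCode]; simp [h]

theorem Body.ofCode_neg {c : ℕ} (h : c % 5 = 1) : Body.ofCode c = .neg (Body.ofCode (c / 5)) := by
  rw [Body.ofCode]; simp [h]

theorem Body.ofCode_nextOp {c : ℕ} (h : c % 5 = 2) :
    Body.ofCode c = .nextOp (Body.ofCode (c / 5)) := by
  rw [Body.ofCode]; simp [h]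

theorem Body.ofCode_conj {c : ℕ} (h : c % 5 = 3) :
    Body.ofCode c = .conj (Body.ofCode (c / 5).unpair.1) (Body.ofCode (c / 5).unpair.2) := by
  rw [Body.ofCode]; simp [h]

theorem Body.ofCode_untilOp {c : ℕ} (h : c % 5 = 4) :
    Body.ofCode c = .untilOp (Body.ofCode (c / 5).unpair.1) (Body.ofCode (c / 5).unpair.2) := by
  rw [Body.ofCode]; simp [h]

theorem TraceAssignment.suffix_suffix (A : TraceAssignment) (i k : ℕ) :
    TraceAssignment.suffix (A.suffix i) k = A.suffix (i + k) := by
  funext π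
  simp only [TraceAssignment.suffix, Option.map_map]
  congr 1
  funext t j
  simp [Trace.suffix, add_assoc]

theorem TraceAssignment.suffix_zero (A : TraceAssignment) : A.suffix 0 = A := by
  funext π
  have : (fun t : Trace => t.suffix 0) = id := by
    funext t j
    simp [Trace.suffix]
  simp [TraceAssignment.suffix, this]

theorem Body.holds_untilOp_suffix (ψ χ : Body) (A : TraceAssignment) (i : ℕ) :
    (Body.untilOp ψ χ).Holds (A.suffix i) ↔
      ∃ k, χ.Holds (A.suffix (i + k)) ∧ ∀ j < k, ψ.Holds (A.suffix (i + j)) := by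
  simp [Body.Holds, TraceAssignment.suffix_suffix]

/-- The expansion law of the until operator, and the fact that an until operator that holds is
fulfilled eventually, characterise the operator. -/
theorem until_iff_of_expansion {P Q U : ℕ → Prop} (hU : ∀ i, U i ↔ Q i ∨ P i ∧ U (i + 1))
    (hfair : ∀ i, ∃ j ≥ i, ¬ U j ∨ Q j) (i : ℕ) :
    U i ↔ ∃ k, Q (i + k) ∧ ∀ j < k, P (i + j) := by
  constructor
  -- Induction on the distance to a moment at which the until is false or fulfilled. Without such a
  -- moment the expansion law would also allow an until that is postponed forever.
  · obtain ⟨j, hj, h⟩ := hfair i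
    obtain ⟨d, rfl⟩ := Nat.exists_eq_add_of_le hj
    clear hj
    induction d generalizing i with
    | zero =>
      intro hi
      exact ⟨0, h.resolve_left (fun h' => h' hi), by simp⟩
    | succ d ih =>
      intro hi
      rcases (hU i).1 hi with hQ | ⟨hP, hi'⟩
      · exact ⟨0, hQ, by simp⟩
      · obtain ⟨k, hk, hlt⟩ := ih (i + 1) (by rwa [Nat.add_right_comm]) hi'
        refine ⟨k + 1, by rwa [Nat.add_right_comm] at hk, ?_⟩
        rintro (_ | j) hj
        · exact hP
        · have := hlt j (by omega)
          rwa [Nat.add_right_comm] at this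
  · rintro ⟨k, hk, hlt⟩
    induction k generalizing i with
    | zero => exact (hU i).2 (Or.inl hk)
    | succ k ih =>
      refine (hU i).2 (Or.inr ⟨hlt 0 (by omega), ih (i + 1) ?_ fun j hj => ?_⟩)
      · rwa [Nat.add_right_comm]
      · rw [Nat.add_right_comm]
        exact hlt (j + 1) (by omega)

theorem FinSystem.mem_traces_iff (M : FinSystem) (t : Trace) :
    t ∈ M.toTransitionSystem.traces ↔ ∃ p : ℕ → ℕ, (∀ i, p i < M.numStates) ∧ p 0 ∈ M.init ∧
      (∀ i, (p i, p (i + 1)) ∈ M.trans) ∧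
      ∀ i a, a ∈ t i ↔ a ∈ M.props ∧ (p i, a) ∈ M.labels := by
  constructor
  · rintro ⟨p, ⟨h0, hs⟩, hl⟩
    refine ⟨fun i => p i, fun i => (p i).2, h0, hs, fun i a => ?_⟩
    rw [hl]
    simp [FinSystem.toTransitionSystem, FinSystem.AP]
  · rintro ⟨p, hp, h0, hs, hl⟩
    refine ⟨fun i => ⟨p i, hp i⟩, ⟨h0, hs⟩, fun i => ?_⟩
    ext a
    rw [hl]
    simp [FinSystem.toTransitionSystem, FinSystem.AP]

variable (M : FinSystem) (N J F : ℕ) (sys valid : ℕ → Prop) (ρ : ℕ → ℕ → ℕ)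

/-- There are traces `t 0, t 1, …` such that those with an index below `J` in `sys` are traces of
the system and, for all valid `f < F`, the formula with code `N` holds when each trace variable
`π` is read as `t (ρ f π)`. -/
def JointlySatisfiable : Prop :=
  ∃ t : ℕ → Trace,
    (∀ j < J, t j ∈ allTraces M.AP ∧ (sys j → t j ∈ M.toTransitionSystem.traces)) ∧
    ∀ f < F, valid f → (Body.ofCode N).Holds fun π => some (t (ρ f π))

/-- A bit of the state `v`. The bits with tag `0` tell which formulas hold in which reading, those
with tag `1` which atomic propositions hold on which trace, and those with tag `2` which states of
the system the traces are in. -/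
def bit (v tag x y : ℕ) : Prop := v.testBit (Nat.pair tag (Nat.pair x y)) = true

/-- Truth of the formula with code `c` in the reading `f` is consistent with truth of its
immediate subformulas, where `v` and `w` are the present and the next state. -/
def FormulaStep (v w f c : ℕ) : Prop :=
  (c % 5 = 0 → (bit v 0 f c ↔ (c / 5).unpair.1 ∈ M.props ∧
    bit v 1 (c / 5).unpair.1 (ρ f (c / 5).unpair.2))) ∧
  (c % 5 = 1 → (bit v 0 f c ↔ ¬ bit v 0 f (c / 5))) ∧
  (c % 5 = 2 → (bit v 0 f c ↔ bit w 0 f (c / 5))) ∧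
  (c % 5 = 3 → (bit v 0 f c ↔ bit v 0 f (c / 5).unpair.1 ∧ bit v 0 f (c / 5).unpair.2)) ∧
  (c % 5 = 4 → (bit v 0 f c ↔ bit v 0 f (c / 5).unpair.2 ∨
    bit v 0 f (c / 5).unpair.1 ∧ bit w 0 f c))

/-- The trace `j` makes a step of the system. -/
def SystemStep (v w j : ℕ) : Prop :=
  (∃ s < M.numStates, bit v 2 j s) ∧
  ∀ s < M.numStates, bit v 2 j s →
    (∀ a < N + 1, a ∈ M.props → (bit v 1 a j ↔ (s, a) ∈ M.labels)) ∧
    ∀ s' < M.numStates, bit w 2 j s' → (s, s') ∈ M.trans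

def JointStep (v w : ℕ) : Prop :=
  (∀ f < F, ∀ c < N + 1, FormulaStep M ρ v w f c) ∧ ∀ j < J, sys j → SystemStep M N v w j

/-- Truth is tracked for all readings, but only the valid ones are required to make the whole
formula `N` true. -/
def JointStart (v : ℕ) : Prop :=
  (∀ f < F, valid f → bit v 0 f N) ∧
  ∀ j < J, sys j → ∀ s < M.numStates, bit v 2 j s → s ∈ M.init

/-- The fairness condition for the until formula and the reading coded by `k`. -/
def JointFair (k v : ℕ) : Prop :=
  k.unpair.1 < F → k.unpair.2 < N + 1 → k.unpair.2 % 5 = 4 →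
    ¬ bit v 0 k.unpair.1 k.unpair.2 ∨ bit v 0 k.unpair.1 (k.unpair.2 / 5).unpair.2

/-- A bound on the second and third index of the relevant bits of a state. -/
def jointSize : ℕ := N + J + F + M.numStates + 1

variable {M N J F sys valid ρ}

theorem pair_lt_pair_of_lt_of_lt {a b c d : ℕ} (h : a < b) (h' : c < d) :
    Nat.pair a c < Nat.pair b d :=
  (Nat.pair_lt_pair_left c h).trans (Nat.pair_lt_pair_right b h')

/-- The run records what is true of the suffixes of the given traces, together with paths `p j` that
produce the system traces. -/
theorem JointlySatisfiable.hasFairRun (hρ : ∀ f π, ρ f π < J)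
    (h : JointlySatisfiable M N J F sys valid ρ) :
    HasFairRun (2 ^ Nat.pair 3 (Nat.pair (jointSize M N J F) (jointSize M N J F)))
      (Nat.pair F (N + 1)) (JointStart M N J F sys valid) (JointStep M N J F sys ρ)
      (JointFair N F) := by
  obtain ⟨t, ht, hψ⟩ := h
  have hpath : ∀ j, ∃ p : ℕ → ℕ, j < J → sys j →
      (∀ i, p i < M.numStates) ∧ p 0 ∈ M.init ∧ (∀ i, (p i, p (i + 1)) ∈ M.trans) ∧
      ∀ i a, a ∈ t j i ↔ a ∈ M.props ∧ (p i, a) ∈ M.labels := by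
    intro j
    by_cases hj : j < J ∧ sys j
    · obtain ⟨p, hp⟩ := (M.mem_traces_iff _).1 ((ht j hj.1).2 hj.2)
      exact ⟨p, fun _ _ => hp⟩
    · exact ⟨0, fun h1 h2 => absurd ⟨h1, h2⟩ hj⟩
  choose p hp using hpath
  let A : ℕ → TraceAssignment := fun f π => some (t (ρ f π))
  -- The intended meaning at time `i` of the bit with index `e = Nat.pair tag (Nat.pair x y)`.
  let truth : ℕ → ℕ → Prop := fun i e =>
    (e.unpair.1 = 0 → (Body.ofCode e.unpair.2.unpair.2).Holds ((A e.unpair.2.unpair.1).suffix i)) ∧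
    (e.unpair.1 = 1 → e.unpair.2.unpair.1 ∈ t e.unpair.2.unpair.2 i) ∧
    (e.unpair.1 = 2 → p e.unpair.2.unpair.1 i = e.unpair.2.unpair.2)
  choose v hvB hv using fun i => exists_lt_two_pow_testBit (truth i)
    (Nat.pair 3 (Nat.pair (jointSize M N J F) (jointSize M N J F)))
  have hbit : ∀ i tag x y, tag < 3 → x < jointSize M N J F → y < jointSize M N J F →
      (bit (v i) tag x y ↔ truth i (Nat.pair tag (Nat.pair x y))) := fun i tag x y h1 h2 h3 =>
    hv i _ (pair_lt_pair_of_lt_of_lt h1 (pair_lt_pair_of_lt_of_lt h2 h3))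
  have h0 : ∀ i f c, f < F → c < N + 1 →
      (bit (v i) 0 f c ↔ (Body.ofCode c).Holds ((A f).suffix i)) := by
    intro i f c hf hc
    rw [hbit i 0 f c (by omega) (by unfold jointSize; omega) (by unfold jointSize; omega)]
    simp [truth]
  have h1 : ∀ i a j, a < N + 1 → j < J → (bit (v i) 1 a j ↔ a ∈ t j i) := by
    intro i a j ha hj
    rw [hbit i 1 a j (by omega) (by unfold jointSize; omega) (by unfold jointSize; omega)]
    simp [truth]
  have h2 : ∀ i j s, j < J → s < M.numStates → (bit (v i) 2 j s ↔ p j i = s) := by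
    intro i j s hj hs
    rw [hbit i 2 j s (by omega) (by unfold jointSize; omega) (by unfold jointSize; omega)]
    simp [truth]
  have hl : ∀ n : ℕ, (n / 5).unpair.1 ≤ n := fun n =>
    (Nat.unpair_left_le _).trans (Nat.div_le_self _ _)
  have hr : ∀ n : ℕ, (n / 5).unpair.2 ≤ n := fun n =>
    (Nat.unpair_right_le _).trans (Nat.div_le_self _ _)
  refine ⟨v, hvB, ⟨fun f hf hval => ?_, fun j hj hsys s hs hb => ?_⟩, fun i => ⟨?_, ?_⟩, ?_⟩
  · rw [h0 _ _ _ hf (by omega), TraceAssignment.suffix_zero]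
    exact hψ f hf hval
  · rw [h2 _ _ _ hj hs] at hb
    exact hb ▸ (hp j hj hsys).2.1
  · intro f hf c hc
    have hl' : (c / 5).unpair.1 < N + 1 := (hl c).trans_lt hc
    have hr' : (c / 5).unpair.2 < N + 1 := (hr c).trans_lt hc
    have hd : c / 5 < N + 1 := (Nat.div_le_self _ _).trans_lt hc
    refine ⟨fun h => ?_, fun h => ?_, fun h => ?_, fun h => ?_, fun h => ?_⟩
    · rw [h0 _ _ _ hf hc, Body.ofCode_atom h, h1 _ _ _ hl' (hρ _ _)]
      have hAP := (ht _ (hρ f (c / 5).unpair.2)).1 i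
      simp only [Body.Holds, A, TraceAssignment.suffix, Option.map_some, Option.some.injEq,
        exists_eq_left', Trace.suffix, add_zero]
      exact ⟨fun h => ⟨by simpa [FinSystem.AP] using hAP h, h⟩, fun h => h.2⟩
    · rw [h0 _ _ _ hf hc, Body.ofCode_neg h, h0 _ _ _ hf hd]
      rfl
    · rw [h0 _ _ _ hf hc, Body.ofCode_nextOp h, h0 _ _ _ hf hd, Body.Holds,
        TraceAssignment.suffix_suffix]
    · rw [h0 _ _ _ hf hc, Body.ofCode_conj h, h0 _ _ _ hf hl', h0 _ _ _ hf hr']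
      rfl
    · rw [h0 _ _ _ hf hc, h0 _ _ _ hf hc, Body.ofCode_untilOp h, h0 _ _ _ hf hl',
        h0 _ _ _ hf hr', Body.holds_untilOp_suffix, Body.holds_untilOp_suffix]
      constructor
      · rintro ⟨_ | k, hk, hlt⟩
        · exact Or.inl hk
        · refine Or.inr ⟨hlt 0 (by omega), k, by rwa [Nat.add_right_comm], fun j hj => ?_⟩
          rw [Nat.add_right_comm]
          exact hlt (j + 1) (by omega)
      · rintro (h | ⟨h, k, hk, hlt⟩)
        · exact ⟨0, h, by simp⟩
        · refine ⟨k + 1, by rwa [Nat.add_right_comm] at hk, ?_⟩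
          rintro (_ | j) hj
          · exact h
          · have := hlt j (by omega)
            rwa [Nat.add_right_comm] at this
  · intro j hj hsys
    obtain ⟨hp1, -, hp3, hp4⟩ := hp j hj hsys
    refine ⟨⟨p j i, hp1 i, (h2 _ _ _ hj (hp1 i)).2 rfl⟩, fun s hs hb => ⟨fun a ha haP => ?_, ?_⟩⟩
    · rw [h2 _ _ _ hj hs] at hb
      rw [h1 _ _ _ ha hj, hp4, hb]
      simp [haP]
    · intro s' hs' hb'
      rw [h2 _ _ _ hj hs] at hb
      rw [h2 _ _ _ hj hs'] at hb'
      exact hb ▸ hb' ▸ hp3 i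
  · rintro k - i
    -- An until that holds at time `i` is fulfilled at some later time `i + d`; in all other cases
    -- the condition is already met at time `i`.
    by_cases hk : k.unpair.1 < F ∧ k.unpair.2 < N + 1 ∧ k.unpair.2 % 5 = 4
    · obtain ⟨hf, hc, h5⟩ := hk
      have hr' : (k.unpair.2 / 5).unpair.2 < N + 1 := (hr _).trans_lt hc
      by_cases hU : bit (v i) 0 k.unpair.1 k.unpair.2
      · rw [h0 _ _ _ hf hc, Body.ofCode_untilOp h5, Body.holds_untilOp_suffix] at hU
        obtain ⟨d, hd, -⟩ := hU
        exact ⟨i + d, by omega, fun _ _ _ => Or.inr ((h0 _ _ _ hf hr').2 hd)⟩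
      · exact ⟨i, le_rfl, fun _ _ _ => Or.inl hU⟩
    · exact ⟨i, le_rfl, fun h1 h2 h3 => absurd ⟨h1, h2, h3⟩ hk⟩

/-- A state may mark several system states for one trace. `SystemStep` constrains all of them, so
any selection of marked states is a path and uniqueness need not be imposed. -/
theorem HasFairRun.jointlySatisfiable {B : ℕ} (hρ : ∀ f π, ρ f π < J)
    (h : HasFairRun B (Nat.pair F (N + 1)) (JointStart M N J F sys valid)
      (JointStep M N J F sys ρ) (JointFair N F)) :
    JointlySatisfiable M N J F sys valid ρ := by
  classical
  obtain ⟨v, -, ⟨hstart, hinit⟩, hstep, hfair⟩ := h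
  have hpath : ∀ j i, ∃ s, j < J → sys j → s < M.numStates ∧ bit (v i) 2 j s := by
    intro j i
    by_cases hj : j < J ∧ sys j
    · obtain ⟨s, hs, hb⟩ := ((hstep i).2 j hj.1 hj.2).1
      exact ⟨s, fun _ _ => ⟨hs, hb⟩⟩
    · exact ⟨0, fun h1 h2 => absurd ⟨h1, h2⟩ hj⟩
  choose p hp using hpath
  -- For a system trace the letter is read off the label of the selected state and not off the bits,
  -- which are controlled only for propositions up to `N`. The two agree on those.
  let t : ℕ → Trace := fun j i => M.AP.filter fun a =>
    if sys j then (p j i, a) ∈ M.labels else bit (v i) 1 a j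
  have htmem : ∀ j < J, ∀ i, ∀ a < N + 1,
      (a ∈ t j i ↔ a ∈ M.props ∧ bit (v i) 1 a j) := by
    intro j hj i a ha
    by_cases hsys : sys j
    · obtain ⟨hs, hb⟩ := hp j i hj hsys
      have := (((hstep i).2 j hj hsys).2 _ hs hb).1 a ha
      simp only [t, hsys, if_true, Finset.mem_filter, FinSystem.AP, List.mem_toFinset]
      exact ⟨fun h => ⟨h.1, (this h.1).2 h.2⟩, fun h => ⟨h.1, (this h.1).1 h.2⟩⟩
    · simp [t, hsys, FinSystem.AP]
  let A : ℕ → TraceAssignment := fun f π => some (t (ρ f π))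
  have hl : ∀ n : ℕ, (n / 5).unpair.1 ≤ n / 5 := fun n => Nat.unpair_left_le _
  have hr : ∀ n : ℕ, (n / 5).unpair.2 ≤ n / 5 := fun n => Nat.unpair_right_le _
  -- All codes up to `N` are tracked, subformulas of `N` or not. Immediate subformulas have smaller
  -- codes, which drives the induction.
  have key : ∀ f < F, ∀ c < N + 1, ∀ i,
      (bit (v i) 0 f c ↔ (Body.ofCode c).Holds ((A f).suffix i)) := by
    intro f hf c
    induction c using Nat.strong_induction_on with
    | _ c ih =>
      intro hc i
      obtain ⟨e0, e1, e2, e3, e4⟩ := (hstep i).1 f hf c hc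
      have hl' := hl c
      have hr' := hr c
      rcases (by omega : c % 5 = 0 ∨ c % 5 = 1 ∨ c % 5 = 2 ∨ c % 5 = 3 ∨ c % 5 = 4) with
        h | h | h | h | h
      · rw [e0 h, Body.ofCode_atom h, ← htmem _ (hρ _ _) _ _ (by omega)]
        simp [Body.Holds, A, TraceAssignment.suffix, Trace.suffix]
      · rw [e1 h, Body.ofCode_neg h, ih _ (by omega) (by omega)]
        rfl
      · rw [e2 h, Body.ofCode_nextOp h, ih _ (by omega) (by omega), Body.Holds,
          TraceAssignment.suffix_suffix]
      · rw [e3 h, Body.ofCode_conj h, ih _ (by omega) (by omega), ih _ (by omega) (by omega)]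
        rfl
      · rw [Body.ofCode_untilOp h, Body.holds_untilOp_suffix]
        simp only [← ih _ (show (c / 5).unpair.1 < c by omega) (by omega),
          ← ih _ (show (c / 5).unpair.2 < c by omega) (by omega)]
        refine until_iff_of_expansion (U := fun i => bit (v i) 0 f c)
          (P := fun i => bit (v i) 0 f (c / 5).unpair.1)
          (Q := fun i => bit (v i) 0 f (c / 5).unpair.2) (fun i => ?_) (fun i => ?_) i
        · exact ((hstep i).1 f hf c hc).2.2.2.2 h
        · obtain ⟨j, hj, hG⟩ := hfair (Nat.pair f c) (pair_lt_pair_of_lt_of_lt hf hc) i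
          refine ⟨j, hj, ?_⟩
          simpa [JointFair, hf, hc, h] using hG
  refine ⟨t, fun j hj => ⟨fun i => Finset.filter_subset _ _, fun hsys => ?_⟩,
    fun f hf hval => ?_⟩
  · refine (M.mem_traces_iff _).2 ⟨p j, fun i => (hp j i hj hsys).1, ?_, fun i => ?_, ?_⟩
    · exact hinit j hj hsys _ (hp j 0 hj hsys).1 (hp j 0 hj hsys).2
    · exact (((hstep i).2 j hj hsys).2 _ (hp j i hj hsys).1 (hp j i hj hsys).2).2 _
        (hp j (i + 1) hj hsys).1 (hp j (i + 1) hj hsys).2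
    · intro i a
      simp [t, hsys, FinSystem.AP]
  · have := (key f hf N (by omega) 0).1 (hstart f hf hval)
    rwa [TraceAssignment.suffix_zero] at this

theorem jointlySatisfiable_iff (hρ : ∀ f π, ρ f π < J) :
    JointlySatisfiable M N J F sys valid ρ ↔
      HasFairRun (2 ^ Nat.pair 3 (Nat.pair (jointSize M N J F) (jointSize M N J F)))
        (Nat.pair F (N + 1)) (JointStart M N J F sys valid) (JointStep M N J F sys ρ)
        (JointFair N F) :=
  ⟨fun h => h.hasFairRun hρ, fun h => h.jointlySatisfiable hρ⟩

/-! ### Primitive recursiveness of joint satisfiability -/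

@[fun_prop]
theorem primrec_props {α : Type} [Primcodable α] {f : α → FinSystem} (hf : Primrec f) :
    Primrec fun a => (f a).props :=
  have h : Primrec fun a => FinSystem.equivProd (f a) := Primrec.of_equiv.comp hf
  Primrec.fst.comp h

@[fun_prop]
theorem primrec_numStates {α : Type} [Primcodable α] {f : α → FinSystem} (hf : Primrec f) :
    Primrec fun a => (f a).numStates :=
  have h : Primrec fun a => FinSystem.equivProd (f a) := Primrec.of_equiv.comp hf
  Primrec.fst.comp (Primrec.snd.comp h)

@[fun_prop]
theorem primrec_init {α : Type} [Primcodable α] {f : α → FinSystem} (hf : Primrec f) :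
    Primrec fun a => (f a).init :=
  have h : Primrec fun a => FinSystem.equivProd (f a) := Primrec.of_equiv.comp hf
  Primrec.fst.comp (Primrec.snd.comp (Primrec.snd.comp h))

@[fun_prop]
theorem primrec_trans {α : Type} [Primcodable α] {f : α → FinSystem} (hf : Primrec f) :
    Primrec fun a => (f a).trans :=
  have h : Primrec fun a => FinSystem.equivProd (f a) := Primrec.of_equiv.comp hf
  Primrec.fst.comp (Primrec.snd.comp (Primrec.snd.comp (Primrec.snd.comp h)))

@[fun_prop]
theorem primrec_labels {α : Type} [Primcodable α] {f : α → FinSystem} (hf : Primrec f) :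
    Primrec fun a => (f a).labels :=
  have h : Primrec fun a => FinSystem.equivProd (f a) := Primrec.of_equiv.comp hf
  Primrec.snd.comp (Primrec.snd.comp (Primrec.snd.comp (Primrec.snd.comp h)))

section

variable {α : Type} [Primcodable α]

theorem primrecPred_bit {f g h k : α → ℕ} (hf : Primrec f) (hg : Primrec g) (hh : Primrec h)
    (hk : Primrec k) : PrimrecPred fun a => bit (f a) (g a) (h a) (k a) :=
  primrecPred_testBit hf (by fun_prop)

theorem primrecPred_formulaStep {M : α → FinSystem} {ρ : α → ℕ → ℕ → ℕ} (hM : Primrec M)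
    (hρ : Primrec fun x : α × ℕ × ℕ => ρ x.1 x.2.1 x.2.2) {v w f c : α → ℕ} (hv : Primrec v)
    (hw : Primrec w) (hf : Primrec f) (hc : Primrec c) :
    PrimrecPred fun a => FormulaStep (M a) (ρ a) (v a) (w a) (f a) (c a) := by
  have hρ' : Primrec fun a => ρ a (f a) (c a / 5).unpair.2 :=
    hρ.comp (g := fun a => (a, f a, (c a / 5).unpair.2)) (by fun_prop)
  unfold FormulaStep
  repeat' first
    | with_reducible apply primrecPred_exists_lt
    | with_reducible apply primrecPred_forall_lt
    | with_reducible apply primrecPred_and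
    | with_reducible apply primrecPred_or
    | with_reducible apply primrecPred_not
    | with_reducible apply primrecPred_bit
    | with_reducible apply primrecPred_lt
    | with_reducible apply primrecPred_eq
    | with_reducible apply primrecPred_mem_pair
    | with_reducible apply primrecPred_mem
    | with_reducible apply primrecPred_iff
    | with_reducible apply primrecPred_imp
    | fun_prop

theorem primrecPred_systemStep {M : α → FinSystem} {N v w j : α → ℕ} (hM : Primrec M)
    (hN : Primrec N) (hv : Primrec v) (hw : Primrec w) (hj : Primrec j) :
    PrimrecPred fun a => SystemStep (M a) (N a) (v a) (w a) (j a) := by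
  unfold SystemStep
  repeat' first
    | with_reducible apply primrecPred_exists_lt
    | with_reducible apply primrecPred_forall_lt
    | with_reducible apply primrecPred_and
    | with_reducible apply primrecPred_or
    | with_reducible apply primrecPred_not
    | with_reducible apply primrecPred_bit
    | with_reducible apply primrecPred_lt
    | with_reducible apply primrecPred_eq
    | with_reducible apply primrecPred_mem_pair
    | with_reducible apply primrecPred_mem
    | with_reducible apply primrecPred_iff
    | with_reducible apply primrecPred_imp
    | fun_prop

theorem primrecPred_jointStart {M : α → FinSystem} {N J F : α → ℕ} {sys valid : α → ℕ → Prop}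
    (hM : Primrec M) (hN : Primrec N) (hJ : Primrec J) (hF : Primrec F)
    (hsys : PrimrecPred fun x : α × ℕ => sys x.1 x.2)
    (hvalid : PrimrecPred fun x : α × ℕ => valid x.1 x.2) :
    PrimrecPred fun x : α × ℕ =>
      JointStart (M x.1) (N x.1) (J x.1) (F x.1) (sys x.1) (valid x.1) x.2 := by
  unfold JointStart
  refine primrecPred_and (primrecPred_forall_lt (by fun_prop) (primrecPred_imp ?_ ?_))
    (primrecPred_forall_lt (by fun_prop) (primrecPred_imp ?_
      (primrecPred_forall_lt (by fun_prop) (primrecPred_imp ?_ ?_))))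
  · exact hvalid.comp (f := fun x : (α × ℕ) × ℕ => (x.1.1, x.2)) (by fun_prop)
  · exact primrecPred_bit (by fun_prop) (by fun_prop) (by fun_prop) (by fun_prop)
  · exact hsys.comp (f := fun x : (α × ℕ) × ℕ => (x.1.1, x.2)) (by fun_prop)
  · exact primrecPred_bit (by fun_prop) (by fun_prop) (by fun_prop) (by fun_prop)
  · exact primrecPred_mem (by fun_prop) (by fun_prop)

theorem primrecPred_jointStep {M : α → FinSystem} {N J F : α → ℕ} {sys : α → ℕ → Prop}
    {ρ : α → ℕ → ℕ → ℕ} (hM : Primrec M) (hN : Primrec N) (hJ : Primrec J) (hF : Primrec F)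
    (hsys : PrimrecPred fun x : α × ℕ => sys x.1 x.2)
    (hρ : Primrec fun x : α × ℕ × ℕ => ρ x.1 x.2.1 x.2.2) :
    PrimrecPred fun x : α × ℕ × ℕ =>
      JointStep (M x.1) (N x.1) (J x.1) (F x.1) (sys x.1) (ρ x.1) x.2.1 x.2.2 := by
  unfold JointStep
  refine primrecPred_and (primrecPred_forall_lt (by fun_prop)
    (primrecPred_forall_lt (by fun_prop) ?_))
    (primrecPred_forall_lt (by fun_prop) (primrecPred_imp ?_ ?_))
  · refine primrecPred_formulaStep (M := fun x : ((α × ℕ × ℕ) × ℕ) × ℕ => M x.1.1.1)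
      (ρ := fun x : ((α × ℕ × ℕ) × ℕ) × ℕ => ρ x.1.1.1) (by fun_prop) ?_ (by fun_prop)
      (by fun_prop) (by fun_prop) (by fun_prop)
    exact hρ.comp (g := fun x : (((α × ℕ × ℕ) × ℕ) × ℕ) × ℕ × ℕ => (x.1.1.1.1, x.2))
      (by fun_prop)
  · exact hsys.comp (f := fun x : (α × ℕ × ℕ) × ℕ => (x.1.1, x.2)) (by fun_prop)
  · exact primrecPred_systemStep (by fun_prop) (by fun_prop) (by fun_prop) (by fun_prop)
      (by fun_prop)

theorem primrecPred_jointFair {N F : α → ℕ} (hN : Primrec N) (hF : Primrec F) :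
    PrimrecPred fun x : α × ℕ × ℕ => JointFair (N x.1) (F x.1) x.2.1 x.2.2 := by
  unfold JointFair
  refine primrecPred_imp (primrecPred_lt (by fun_prop) (by fun_prop))
    (primrecPred_imp (primrecPred_lt (by fun_prop) (by fun_prop))
      (primrecPred_imp (primrecPred_eq (by fun_prop) (by fun_prop))
        (primrecPred_or (primrecPred_not ?_) ?_))) <;>
  exact primrecPred_bit (by fun_prop) (by fun_prop) (by fun_prop) (by fun_prop)

theorem primrecPred_jointlySatisfiable {M : α → FinSystem}
    {N J F : α → ℕ} {sys valid : α → ℕ → Prop} {ρ : α → ℕ → ℕ → ℕ} (hρ : ∀ a f π, ρ a f π < J a)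
    (hM : Primrec M) (hN : Primrec N) (hJ : Primrec J) (hF : Primrec F)
    (hsys : PrimrecPred fun x : α × ℕ => sys x.1 x.2)
    (hvalid : PrimrecPred fun x : α × ℕ => valid x.1 x.2)
    (hρp : Primrec fun x : α × ℕ × ℕ => ρ x.1 x.2.1 x.2.2) :
    PrimrecPred fun a => JointlySatisfiable (M a) (N a) (J a) (F a) (sys a) (valid a) (ρ a) := by
  have hsize : Primrec fun a => jointSize (M a) (N a) (J a) (F a) := by
    unfold jointSize
    fun_prop
  simp only [jointlySatisfiable_iff (hρ _)]
  exact primrecPred_hasFairRun (by fun_prop) (by fun_prop)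
    (primrecPred_jointStart hM hN hJ hF hsys hvalid)
    (primrecPred_jointStep hM hN hJ hF hsys hρp)
    (primrecPred_jointFair hN hF)

end

end JointSatisfiability

/-! ### First-order quantifiers as traces at positions -/

section Semantics

theorem Body.holds_congr {AP V : Finset ℕ} {ψ : Body} (hψ : ψ.WellFormed AP V)
    {A B : TraceAssignment} (h : ∀ π ∈ V, A π = B π) : ψ.Holds A ↔ ψ.Holds B := by
  induction ψ generalizing A B with
  | atom a π => simp only [Body.Holds, h π hψ.2]
  | neg ψ ih => simp only [Body.Holds, ih hψ h]
  | conj ψ χ ih ih' => simp only [Body.Holds, ih hψ.1 h, ih' hψ.2 h]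
  | nextOp ψ ih =>
    exact ih hψ fun π hπ => by simp only [TraceAssignment.suffix, h π hπ]
  | untilOp ψ χ ih ih' =>
    have h' : ∀ i, ∀ π ∈ V, A.suffix i π = B.suffix i π := fun i π hπ => by
      simp only [TraceAssignment.suffix, h π hπ]
    simp only [Body.Holds, fun i => ih hψ.1 (h' i), fun i => ih' hψ.2 (h' i)]

/-- A number that stands for a quantifier. -/
def Quant.num : Quant → ℕ
  | .all => 0
  | .ex => 1

/-- The shape of a quantification (`Q.num` for a first-order and `Q.num + 2` for a second-order
quantification), its trace variable (if any) and its second-order variable. -/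
def Quantification.info : Quantification → ℕ × ℕ × ℕ
  | .trace Q π X => (Q.num, π, X)
  | .set Q X => (Q.num + 2, 0, X)

/-- The data of the quantification at position `l`. -/
def infoAt (qs : List Quantification) (l : ℕ) : ℕ × ℕ × ℕ :=
  ((qs[l]?).map Quantification.info).getD (4, 0, 0)

theorem Quant.num_lt (Q : Quant) : Q.num < 2 := by cases Q <;> decide

theorem Quant.num_injective : Function.Injective Quant.num := by
  intro Q Q'
  cases Q <;> cases Q' <;> simp [Quant.num]

/-- The position of the last quantification that binds the trace variable `π`, or the length of
the list if there is none. -/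
def lastBinder (qs : List Quantification) (π : ℕ) : ℕ :=
  (qs.foldl (fun p q => (p.1 + 1, if q.info.1 < 2 ∧ q.info.2.1 = π then p.1 else p.2))
    (0, qs.length)).2

theorem lastBinder_lt (qs : List Quantification) (π : ℕ) : lastBinder qs π < qs.length + 1 := by
  have h : ∀ (qs : List Quantification) (k d n : ℕ), k + qs.length ≤ n → d ≤ n →
      (qs.foldl (fun p q => (p.1 + 1, if q.info.1 < 2 ∧ q.info.2.1 = π then p.1 else p.2))
        (k, d)).2 ≤ n := by
    intro qs
    induction qs with
    | nil => intro k d n _ hd; exact hd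
    | cons q qs ih =>
      intro k d n hk hd
      simp only [List.length_cons] at hk
      simp only [List.foldl_cons]
      refine ih _ _ _ (by omega) ?_
      split_ifs <;> omega
  exact Nat.lt_succ_of_le (h qs 0 _ _ (by omega) le_rfl)

/-- The map from trace variables to positions after the quantification of the trace variables in
`ps` at the positions from `k` on. -/
def bindFrom : List (ℕ × ℕ) → ℕ → (ℕ → Option ℕ) → ℕ → Option ℕ
  | [], _, r => r
  | p :: ps, k, r => bindFrom ps (k + 1) (Function.update r p.1 (some k))

theorem bindFrom_append (ps ps' : List (ℕ × ℕ)) (k : ℕ) (r : ℕ → Option ℕ) :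
    bindFrom (ps ++ ps') k r = bindFrom ps' (k + ps.length) (bindFrom ps k r) := by
  induction ps generalizing k r with
  | nil => rfl
  | cons p ps ih =>
    simp only [List.cons_append, bindFrom, ih, List.length_cons]
    congr 1
    omega

theorem bindFrom_eq_some {ps : List (ℕ × ℕ)} {k : ℕ} {r : ℕ → Option ℕ} {π l : ℕ}
    (h : bindFrom ps k r π = some l) : (k ≤ l ∧ l < k + ps.length) ∨ r π = some l := by
  induction ps generalizing k r with
  | nil => exact Or.inr h
  | cons p ps ih =>
    simp only [List.length_cons]
    rcases ih h with ⟨h1, h2⟩ | h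
    · exact Or.inl (by omega)
    · by_cases hp : π = p.1
      · subst hp
        simp at h
        exact Or.inl (by omega)
      · rw [Function.update_of_ne hp] at h
        exact Or.inr h

theorem isSome_bindFrom {ps : List (ℕ × ℕ)} {k : ℕ} {r : ℕ → Option ℕ} {π : ℕ}
    (h : (∃ p ∈ ps, p.1 = π) ∨ (r π).isSome) : (bindFrom ps k r π).isSome := by
  induction ps generalizing k r with
  | nil => simpa [bindFrom] using h
  | cons p ps ih =>
    refine ih ?_
    by_cases hp : π = p.1
    · subst hp
      simp
    · rw [Function.update_of_ne hp]
      simpa [Ne.symm hp] using h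

theorem foldl_set (Q : Quant) (Xs : List ℕ) (π k d : ℕ) :
    (Xs.map (Quantification.set Q)).foldl
      (fun p q => (p.1 + 1, if q.info.1 < 2 ∧ q.info.2.1 = π then p.1 else p.2)) (k, d) =
    (k + Xs.length, d) := by
  induction Xs generalizing k with
  | nil => rfl
  | cons X Xs ih =>
    simp only [List.map_cons, List.foldl_cons, List.length_cons]
    have : ¬ ((Quantification.set Q X).info.1 < 2 ∧ (Quantification.set Q X).info.2.1 = π) := by
      simp [Quantification.info]
    rw [if_neg this, ih]
    simp only [Prod.mk.injEq, and_true]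
    omega

theorem foldl_trace (Q : Quant) (ps : List (ℕ × ℕ)) (π k d : ℕ) (r : ℕ → Option ℕ) :
    (ps.map fun p => Quantification.trace Q p.1 p.2).foldl
      (fun p q => (p.1 + 1, if q.info.1 < 2 ∧ q.info.2.1 = π then p.1 else p.2))
      (k, (r π).getD d) =
    (k + ps.length, (bindFrom ps k r π).getD d) := by
  induction ps generalizing k r with
  | nil => rfl
  | cons p ps ih =>
    simp only [List.map_cons, List.foldl_cons, List.length_cons, bindFrom]
    have : (if (Quantification.trace Q p.1 p.2).info.1 < 2 ∧
        (Quantification.trace Q p.1 p.2).info.2.1 = π then k else (r π).getD d) =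
        (Function.update r p.1 (some k) π).getD d := by
      by_cases hp : π = p.1
      · subst hp
        simp [Quantification.info, Q.num_lt]
      · simp [Quantification.info, Function.update_of_ne hp, Ne.symm hp]
    rw [this, ih]
    simp only [Prod.mk.injEq, and_true]
    omega

/-- Variables may be bound repeatedly; on both sides a later binding overrides an earlier one. An
unbound variable gets the length of the whole list. -/
theorem lastBinder_eq (Q Q' Q'' : Quant) (Xs : List ℕ) (ps ps' : List (ℕ × ℕ)) (π : ℕ) :
    lastBinder (Xs.map (Quantification.set Q) ++
      (ps.map (fun p => Quantification.trace Q' p.1 p.2) ++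
        ps'.map (fun p => Quantification.trace Q'' p.1 p.2))) π =
      (bindFrom (ps ++ ps') Xs.length (fun _ => none) π).getD
        (Xs.length + (ps.length + ps'.length)) := by
  have h := foldl_trace Q' ps π Xs.length (Xs.length + (ps.length + ps'.length)) fun _ => none
  simp only [Option.getD_none] at h
  simp only [lastBinder, List.foldl_append, foldl_set, List.length_append, List.length_map]
  rw [Nat.zero_add, h, foldl_trace, bindFrom_append]

theorem holds_traces_neg {AP : Finset ℕ} {ψ : Body} (ps : List (ℕ × ℕ)) (A : TraceAssignment)
    (D : SetAssignment) :
    Holds AP ψ (ps.map fun p => .trace .all p.1 p.2) A D ↔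
      ¬ Holds AP ψ.neg (ps.map fun p => .trace .ex p.1 p.2) A D := by
  induction ps generalizing A with
  | nil => simp [Holds, Body.Holds]
  | cons p ps ih =>
    simp only [List.map_cons, Holds, ih, Quant.Over]
    push Not
    rfl

/-- An assignment is split into a map `r` from variables to positions and a sequence `t` of traces.
Binding a variable uses the fresh position `k`, so the trace of a shadowed quantifier survives and
its membership condition can still be stated. The hypothesis `hr` says that `k` is fresh. -/
theorem holds_traces_ex {AP : Finset ℕ} {ψ : Body} {D : SetAssignment} (ps : List (ℕ × ℕ))
    (rest : List Quantification) (k : ℕ) (t : ℕ → Trace) (r : ℕ → Option ℕ)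
    (hr : ∀ π l, r π = some l → l < k) :
    Holds AP ψ (ps.map (fun p => .trace .ex p.1 p.2) ++ rest) (fun π => (r π).map t) D ↔
      ∃ t' : ℕ → Trace, (∀ l < k, t' l = t l) ∧
        (∀ j p, ps[j]? = some p → t' (k + j) ∈ (D p.2).getD ∅) ∧
        Holds AP ψ rest (fun π => (bindFrom ps k r π).map t') D := by
  induction ps generalizing k t r with
  | nil =>
    constructor
    · intro h
      exact ⟨t, fun _ _ => rfl, by simp, h⟩
    · rintro ⟨t', ht', -, h⟩
      have heq : (fun π => (r π).map t) = fun π => (r π).map t' := by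
        funext π
        rcases hπ : r π with _ | l
        · rfl
        · simp [ht' l (hr π l hπ)]
      rw [heq]
      exact h
  | cons p ps ih =>
    have hr' : ∀ π l, Function.update r p.1 (some k) π = some l → l < k + 1 := by
      intro π l h
      by_cases hp : π = p.1
      · subst hp
        simp at h
        omega
      · rw [Function.update_of_ne hp] at h
        exact (hr π l h).trans (Nat.lt_succ_self _)
    have hupd : ∀ x : Trace, Function.update (fun π => (r π).map t) p.1 (some x) =
        fun π => (Function.update r p.1 (some k) π).map (Function.update t k x) := by
      intro x
      funext π
      by_cases hp : π = p.1
      · subst hp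
        simp
      · simp only [Function.update_of_ne hp]
        rcases hπ : r π with _ | l
        · rfl
        · simp [Function.update_of_ne (hr π l hπ).ne]
    simp only [List.map_cons, List.cons_append, Holds, Quant.Over, hupd, ih _ _ _ hr', bindFrom]
    constructor
    · rintro ⟨x, hx, t', ht', hps, hH⟩
      refine ⟨t', fun l hl => ?_, ?_, hH⟩
      · rw [ht' l (by omega), Function.update_of_ne hl.ne]
      · rintro (_ | j) q hq
        · simp at hq
          subst hq
          rwa [Nat.add_zero, ht' k (by omega), Function.update_self]
        · have := hps j q (by simpa using hq)
          rwa [Nat.add_right_comm] at this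
    · rintro ⟨t', ht', hps, hH⟩
      refine ⟨t' k, hps 0 p (by simp), t', fun l hl => ?_, fun j q hq => ?_, hH⟩
      · rcases Nat.lt_succ_iff_lt_or_eq.1 hl with h | rfl
        · rw [ht' l h, Function.update_of_ne h.ne]
        · rw [Function.update_self]
      · rw [Nat.add_right_comm]
        exact hps (j + 1) q (by simpa using hq)

theorem holds_traces_all {AP : Finset ℕ} {ψ : Body} {D : SetAssignment} (ps : List (ℕ × ℕ))
    (k : ℕ) (t : ℕ → Trace) (r : ℕ → Option ℕ) (hr : ∀ π l, r π = some l → l < k) :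
    Holds AP ψ (ps.map (fun p => .trace .all p.1 p.2)) (fun π => (r π).map t) D ↔
      ∀ t' : ℕ → Trace, (∀ l < k, t' l = t l) →
        (∀ j p, ps[j]? = some p → t' (k + j) ∈ (D p.2).getD ∅) →
        ψ.Holds fun π => (bindFrom ps k r π).map t' := by
  have h := holds_traces_ex (AP := AP) (ψ := ψ.neg) (D := D) ps [] k t r hr
  rw [List.append_nil] at h
  rw [holds_traces_neg, h]
  simp only [Holds, Body.Holds]
  push Not
  rfl

/-! ### Monotonicity and the elimination of set quantifiers -/

theorem holds_traces_ex_mono {AP : Finset ℕ} {ψ : Body} {D D' : SetAssignment}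
    (hD : ∀ Y, (D Y).getD ∅ ⊆ (D' Y).getD ∅) (ps : List (ℕ × ℕ)) (A : TraceAssignment)
    (h : Holds AP ψ (ps.map fun p => .trace .ex p.1 p.2) A D) :
    Holds AP ψ (ps.map fun p => .trace .ex p.1 p.2) A D' := by
  induction ps generalizing A with
  | nil => exact h
  | cons p ps ih =>
    obtain ⟨x, hx, hH⟩ := h
    exact ⟨x, hD _ hx, ih _ hH⟩

/-- The assignment that gives the value `U` to the variables in `Xs`. -/
def setAll (Xs : List ℕ) (U : Set Trace) (D : SetAssignment) : SetAssignment :=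
  fun Y => if Y ∈ Xs then some U else D Y

theorem setAll_nil (U : Set Trace) (D : SetAssignment) : setAll [] U D = D := by
  funext Y
  simp [setAll]

theorem setAll_cons (X : ℕ) (Xs : List ℕ) (U : Set Trace) (D : SetAssignment) :
    setAll (X :: Xs) U D = setAll Xs U (Function.update D X (some U)) := by
  funext Y
  by_cases h : Y = X
  · subst h
    by_cases h' : Y ∈ Xs <;> simp [setAll, h']
  · simp [setAll, h]

theorem setAll_update_mono (Xs : List ℕ) (W : Set Trace) (D : SetAssignment) (X : ℕ)
    {U U' : Set Trace} (h : U ⊆ U') (Y : ℕ) :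
    (setAll Xs W (Function.update D X (some U)) Y).getD ∅ ⊆
      (setAll Xs W (Function.update D X (some U')) Y).getD ∅ := by
  unfold setAll
  split_ifs
  · exact le_rfl
  · by_cases hY : Y = X
    · subst hY
      simpa using h
    · simp [Function.update_of_ne hY]

/-- If `U₀` is always the best choice for existentially quantified second-order variables, then
these quantifications can be replaced by that choice. -/
theorem holds_sets_ex {AP : Finset ℕ} {ψ : Body} {rest : List Quantification}
    {A : TraceAssignment} {U₀ : Set Trace} (hU₀ : U₀ ⊆ allTraces AP)
    (hbest : ∀ Xs D X, ∀ U ⊆ allTraces AP,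
      Holds AP ψ rest A (setAll Xs U₀ (Function.update D X (some U))) →
      Holds AP ψ rest A (setAll Xs U₀ (Function.update D X (some U₀))))
    (Xs : List ℕ) (D : SetAssignment) :
    Holds AP ψ (Xs.map (Quantification.set .ex) ++ rest) A D ↔
      Holds AP ψ rest A (setAll Xs U₀ D) := by
  induction Xs generalizing D with
  | nil => rw [setAll_nil, List.map_nil, List.nil_append]
  | cons X Xs ih =>
    simp only [List.map_cons, List.cons_append, Holds, Quant.Over, ih, setAll_cons]
    exact ⟨fun ⟨U, hU, h⟩ => hbest _ _ _ U hU h, fun h => ⟨U₀, hU₀, h⟩⟩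

/-- If `U₀` is always the worst choice for universally quantified second-order variables, then
these quantifications can be replaced by that choice. -/
theorem holds_sets_all {AP : Finset ℕ} {ψ : Body} {rest : List Quantification}
    {A : TraceAssignment} {U₀ : Set Trace} (hU₀ : U₀ ⊆ allTraces AP)
    (hworst : ∀ Xs D X, ∀ U ⊆ allTraces AP,
      Holds AP ψ rest A (setAll Xs U₀ (Function.update D X (some U₀))) →
      Holds AP ψ rest A (setAll Xs U₀ (Function.update D X (some U))))
    (Xs : List ℕ) (D : SetAssignment) :
    Holds AP ψ (Xs.map (Quantification.set .all) ++ rest) A D ↔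
      Holds AP ψ rest A (setAll Xs U₀ D) := by
  induction Xs generalizing D with
  | nil => rw [setAll_nil, List.map_nil, List.nil_append]
  | cons X Xs ih =>
    simp only [List.map_cons, List.cons_append, Holds, Quant.Over, ih, setAll_cons]
    exact ⟨fun h => h U₀ hU₀, fun h U hU => hworst _ _ _ U hU h⟩

/-- Existential trace quantifiers profit from larger sets, so the full set is the best choice and,
in `holds_all_ex`, the empty set the worst. -/
theorem holds_ex_ex {AP : Finset ℕ} {ψ : Body} {A : TraceAssignment} {D : SetAssignment}
    (Xs : List ℕ) (ps : List (ℕ × ℕ)) :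
    Holds AP ψ (Xs.map (Quantification.set .ex) ++ ps.map (fun p => .trace .ex p.1 p.2)) A D ↔
      Holds AP ψ (ps.map fun p => .trace .ex p.1 p.2) A (setAll Xs (allTraces AP) D) :=
  holds_sets_ex le_rfl (fun _ _ _ _ hU h =>
    holds_traces_ex_mono (setAll_update_mono _ _ _ _ hU) _ _ h) Xs D

theorem holds_all_ex {AP : Finset ℕ} {ψ : Body} {A : TraceAssignment} {D : SetAssignment}
    (Xs : List ℕ) (ps : List (ℕ × ℕ)) :
    Holds AP ψ (Xs.map (Quantification.set .all) ++ ps.map (fun p => .trace .ex p.1 p.2)) A D ↔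
      Holds AP ψ (ps.map fun p => .trace .ex p.1 p.2) A (setAll Xs ∅ D) :=
  holds_sets_all (Set.empty_subset _) (fun _ _ _ _ _ h =>
    holds_traces_ex_mono (setAll_update_mono _ _ _ _ (Set.empty_subset _)) _ _ h) Xs D

/-- For universal trace quantifiers the order is reversed; passing to the negated body leaves only
existential ones to be examined. -/
theorem holds_ex_all {AP : Finset ℕ} {ψ : Body} {A : TraceAssignment} {D : SetAssignment}
    (Xs : List ℕ) (ps : List (ℕ × ℕ)) :
    Holds AP ψ (Xs.map (Quantification.set .ex) ++ ps.map (fun p => .trace .all p.1 p.2)) A D ↔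
      ¬ Holds AP ψ.neg (ps.map fun p => .trace .ex p.1 p.2) A (setAll Xs ∅ D) := by
  rw [← holds_traces_neg]
  refine holds_sets_ex (Set.empty_subset _) (fun _ _ _ _ _ h => ?_) Xs D
  rw [holds_traces_neg] at h ⊢
  exact fun h' => h (holds_traces_ex_mono
    (setAll_update_mono _ _ _ _ (Set.empty_subset _)) _ _ h')

theorem holds_all_all {AP : Finset ℕ} {ψ : Body} {A : TraceAssignment} {D : SetAssignment}
    (Xs : List ℕ) (ps : List (ℕ × ℕ)) :
    Holds AP ψ (Xs.map (Quantification.set .all) ++ ps.map (fun p => .trace .all p.1 p.2)) A D ↔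
      ¬ Holds AP ψ.neg (ps.map fun p => .trace .ex p.1 p.2) A
        (setAll Xs (allTraces AP) D) := by
  rw [← holds_traces_neg]
  refine holds_sets_all le_rfl (fun _ _ _ _ hU h => ?_) Xs D
  rw [holds_traces_neg] at h ⊢
  exact fun h' => h (holds_traces_ex_mono (setAll_update_mono _ _ _ _ hU) _ _ h')

end Semantics

/-! ### Well-formedness in terms of positions and codes -/

section Criteria

theorem infoAt_zero (q : Quantification) (qs : List Quantification) :
    infoAt (q :: qs) 0 = q.info := rfl

theorem infoAt_succ (q : Quantification) (qs : List Quantification) (l : ℕ) :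
    infoAt (q :: qs) (l + 1) = infoAt qs l := by simp [infoAt]

theorem infoAt_of_getElem? {qs : List Quantification} {l : ℕ} {q : Quantification}
    (h : qs[l]? = some q) : infoAt qs l = q.info := by simp [infoAt, h]

theorem infoAt_append_left {qs : List Quantification} (qs' : List Quantification) {l : ℕ}
    (h : l < qs.length) : infoAt (qs ++ qs') l = infoAt qs l := by
  simp [infoAt, List.getElem?_append_left h]

theorem infoAt_append_right (qs qs' : List Quantification) (l : ℕ) :
    infoAt (qs ++ qs') (qs.length + l) = infoAt qs' l := by
  simp [infoAt, List.getElem?_append_right]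

theorem infoAt_of_length_le {qs : List Quantification} {l : ℕ} (h : qs.length ≤ l) :
    infoAt qs l = (4, 0, 0) := by simp [infoAt, h]

/-- Links the bounded quantifiers over positions, which are visibly primitive recursive, with
membership in the list, which is convenient for proofs. -/
theorem exists_infoAt_iff (qs : List Quantification) (P : ℕ × ℕ × ℕ → Prop) :
    (∃ l < qs.length, P (infoAt qs l)) ↔ ∃ q ∈ qs, P q.info := by
  induction qs with
  | nil => simp
  | cons q qs ih =>
    rw [List.length_cons, Nat.exists_lt_succ_left]
    simp [infoAt_zero, infoAt_succ, ih]

theorem forall_infoAt_iff (qs : List Quantification) (P : ℕ × ℕ × ℕ → Prop) :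
    (∀ l < qs.length, P (infoAt qs l)) ↔ ∀ q ∈ qs, P q.info := by
  have h := exists_infoAt_iff qs fun i => ¬ P i
  rw [← not_iff_not]
  push Not
  exact h

/-- The trace variable `π` is bound by one of the quantifications. -/
def IsBound (qs : List Quantification) (π : ℕ) : Prop :=
  ∃ l < qs.length, (infoAt qs l).1 < 2 ∧ (infoAt qs l).2.1 = π

/-- All occurrences of second-order variables are special or bound. -/
def IsScoped (qs : List Quantification) : Prop :=
  ∀ l < qs.length, (infoAt qs l).1 < 2 →
    (infoAt qs l).2.2 = 0 ∨ (infoAt qs l).2.2 = 1 ∨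
      ∃ k < l, 2 ≤ (infoAt qs k).1 ∧ (infoAt qs k).2.2 = (infoAt qs l).2.2

/-- `V'` is the set of trace variables in scope at the body. It is given by its elements so that it
stays fixed while `V` grows in the induction. -/
theorem wellFormedIn_iff {AP : Finset ℕ} {ψ : Body} (qs : List Quantification)
    (V W V' : Finset ℕ) (hV' : ∀ π, π ∈ V' ↔ π ∈ V ∨ IsBound qs π) :
    WellFormedIn AP ψ qs V W ↔
      (∀ l < qs.length, (infoAt qs l).1 < 2 →
        (infoAt qs l).2.2 ∈ W ∨
          ∃ k < l, 2 ≤ (infoAt qs k).1 ∧ (infoAt qs k).2.2 = (infoAt qs l).2.2) ∧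
      ψ.WellFormed AP V' := by
  induction qs generalizing V W with
  | nil =>
    have : V = V' := by
      ext π
      simp [hV', IsBound]
    simp [WellFormedIn, this]
  | cons q qs ih =>
    have hb : ∀ π, IsBound (q :: qs) π ↔ (q.info.1 < 2 ∧ q.info.2.1 = π) ∨ IsBound qs π := by
      intro π
      unfold IsBound
      rw [List.length_cons, Nat.exists_lt_succ_left]
      simp [infoAt_zero, infoAt_succ]
    rw [List.length_cons, Nat.forall_lt_succ_left]
    simp only [infoAt_zero, infoAt_succ, Nat.exists_lt_succ_left]
    cases q with
    | trace Q π X =>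
      simp only [WellFormedIn]
      rw [ih (insert π V) W fun π' => by
        rw [hV', hb]
        simp only [Quantification.info, Q.num_lt, true_and, Finset.mem_insert]
        tauto]
      simp [Quantification.info, Q.num_lt, not_le.2 Q.num_lt, and_assoc]
    | set Q X =>
      simp only [WellFormedIn]
      rw [ih V (insert X W) fun π' => by
        rw [hV', hb]
        simp [Quantification.info]]
      simp only [Quantification.info, Finset.mem_insert]
      refine and_congr ⟨fun h => ⟨fun h' => absurd h' (by omega), fun l hl hk => ?_⟩,
        fun h l hl hk => ?_⟩ Iff.rfl
      · rcases h l hl hk with (h | h) | h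
        · exact Or.inr (Or.inl ⟨by omega, h.symm⟩)
        · exact Or.inl h
        · exact Or.inr (Or.inr h)
      · rcases h.2 l hl hk with h | ⟨-, h⟩ | h
        · exact Or.inl (Or.inr h)
        · exact Or.inl (Or.inl h.symm)
        · exact Or.inr h

/-- The body with code `N` only uses the given atomic propositions and trace variables: there is
a set of codes, given by the bits of `s`, which contains `N`, is closed under immediate
subformulas, and contains only good atoms. -/
def IsGoodBody (props : List ℕ) (N : ℕ) (P : ℕ → Prop) : Prop :=
  ∃ s < 2 ^ (N + 1), s.testBit N = true ∧ ∀ c < N + 1, s.testBit c = true →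
    (c % 5 = 0 → (c / 5).unpair.1 ∈ props ∧ P (c / 5).unpair.2) ∧
    (c % 5 = 1 ∨ c % 5 = 2 → s.testBit (c / 5) = true) ∧
    (2 < c % 5 → s.testBit (c / 5).unpair.1 = true ∧ s.testBit (c / 5).unpair.2 = true)

/-- The codes up to `N` of well-formed bodies form a closed set `s`; conversely, membership in a
closed set gives well-formedness by induction on the code. -/
theorem Body.wellFormed_ofCode_iff (props : List ℕ) (N : ℕ) (P : ℕ → Prop) (V : Finset ℕ)
    (hV : ∀ π, π ∈ V ↔ P π) :
    (Body.ofCode N).WellFormed props.toFinset V ↔ IsGoodBody props N P := by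
  have hl : ∀ n : ℕ, (n / 5).unpair.1 ≤ n / 5 := fun n => Nat.unpair_left_le _
  have hr : ∀ n : ℕ, (n / 5).unpair.2 ≤ n / 5 := fun n => Nat.unpair_right_le _
  constructor
  · intro h
    obtain ⟨s, hs, hmem⟩ := exists_lt_two_pow_testBit
      (fun c => (Body.ofCode c).WellFormed props.toFinset V) (N + 1)
    refine ⟨s, hs, (hmem N (by omega)).2 h, fun c hc hb => ?_⟩
    have hl' := hl c
    have hr' := hr c
    rw [hmem c hc] at hb
    rw [hmem _ (by omega), hmem _ (by omega), hmem _ (by omega)]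
    refine ⟨fun h5 => ?_, fun h5 => ?_, fun h5 => ?_⟩
    · rw [Body.ofCode_atom h5] at hb
      exact ⟨by simpa using hb.1, (hV _).1 hb.2⟩
    · rcases h5 with h5 | h5
      · rwa [Body.ofCode_neg h5] at hb
      · rwa [Body.ofCode_nextOp h5] at hb
    · rcases (by omega : c % 5 = 3 ∨ c % 5 = 4) with h5 | h5
      · rwa [Body.ofCode_conj h5] at hb
      · rwa [Body.ofCode_untilOp h5] at hb
  · rintro ⟨s, -, hN, hs⟩
    have key : ∀ c < N + 1, s.testBit c = true →
        (Body.ofCode c).WellFormed props.toFinset V := by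
      intro c
      induction c using Nat.strong_induction_on with
      | _ c ih =>
        intro hc hb
        obtain ⟨e0, e1, e2⟩ := hs c hc hb
        have hl' := hl c
        have hr' := hr c
        rcases (by omega : c % 5 = 0 ∨ c % 5 = 1 ∨ c % 5 = 2 ∨ c % 5 = 3 ∨ c % 5 = 4) with
          h | h | h | h | h
        · rw [Body.ofCode_atom h]
          exact ⟨by simpa using (e0 h).1, (hV _).2 (e0 h).2⟩
        · rw [Body.ofCode_neg h]
          exact ih (c / 5) (by omega) (by omega) (e1 (Or.inl h))
        · rw [Body.ofCode_nextOp h]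
          exact ih (c / 5) (by omega) (by omega) (e1 (Or.inr h))
        · rw [Body.ofCode_conj h]
          exact ⟨ih _ (by omega) (by omega) (e2 (by omega)).1,
            ih _ (by omega) (by omega) (e2 (by omega)).2⟩
        · rw [Body.ofCode_untilOp h]
          exact ⟨ih _ (by omega) (by omega) (e2 (by omega)).1,
            ih _ (by omega) (by omega) (e2 (by omega)).2⟩
    exact key N (by omega) hN

theorem exists_finset_isBound (qs : List Quantification) :
    ∃ V : Finset ℕ, ∀ π, π ∈ V ↔ IsBound qs π :=
  ⟨((Finset.range qs.length).filter fun l => (infoAt qs l).1 < 2).image fun l =>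
    (infoAt qs l).2.1, fun π => by simp [IsBound, and_assoc]⟩

theorem Formula.wellFormed_iff_of_isBound (AP : Finset ℕ) (φ : Formula) {V : Finset ℕ}
    (hV : ∀ π, π ∈ V ↔ IsBound φ.quants π) :
    φ.WellFormed AP ↔ IsScoped φ.quants ∧ φ.body.WellFormed AP V := by
  rw [Formula.WellFormed, wellFormedIn_iff _ _ _ V (by simpa using hV)]
  simp [IsScoped, sysVar, allVar, or_assoc]

theorem Formula.wellFormed_iff (M : FinSystem) (φ : Formula) :
    φ.WellFormed M.AP ↔
      IsScoped φ.quants ∧ IsGoodBody M.props φ.body.code (IsBound φ.quants) := by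
  obtain ⟨V, hV⟩ := exists_finset_isBound φ.quants
  rw [Formula.wellFormed_iff_of_isBound _ _ hV, ← Body.wellFormed_ofCode_iff _ _ _ V hV,
    Body.ofCode_code]
  rfl

/-! ### Satisfiability criteria for the first four fragments -/

/-- The quantification at position `l` ranges over the set of traces of the system. -/
def IsSystemPosition (qs : List Quantification) (l : ℕ) : Prop :=
  (infoAt qs l).1 < 2 ∧ (infoAt qs l).2.2 = 0 ∧
    ∀ k < qs.length, 2 ≤ (infoAt qs k).1 → (infoAt qs k).2.2 ≠ 0

/-- No first-order quantification ranges over a quantified second-order variable. -/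
def AvoidsSets (qs : List Quantification) : Prop :=
  ∀ l < qs.length, (infoAt qs l).1 < 2 →
    ∀ k < qs.length, 2 ≤ (infoAt qs k).1 → (infoAt qs k).2.2 ≠ (infoAt qs l).2.2

/-- The formula with code `N` is satisfiable by traces for the first-order quantifications in
`qs`, where second-order variables other than that of the set of traces of the system are read as
the set of all traces. -/
def IsSatisfiableFor (M : FinSystem) (N : ℕ) (qs : List Quantification) : Prop :=
  JointlySatisfiable M N (qs.length + 1) 1 (IsSystemPosition qs) (fun _ => True)
    fun _ π => lastBinder qs π

theorem FinSystem.traces_subset (M : FinSystem) :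
    M.toTransitionSystem.traces ⊆ allTraces M.AP := by
  rintro t ⟨p, -, hl⟩ i
  rw [hl]
  exact M.toTransitionSystem.label_subset _

/-- The list of quantifications of a formula in one of the first four fragments. -/
def twoBlocks (Q₁ Q₂ : Quant) (Xs : List ℕ) (ps : List (ℕ × ℕ)) : List Quantification :=
  Xs.map (Quantification.set Q₁) ++ ps.map fun p => .trace Q₂ p.1 p.2

section TwoBlocks

variable {Q₁ Q₂ : Quant} {Xs : List ℕ} {ps : List (ℕ × ℕ)}

theorem exists_mem_twoBlocks_trace (P : ℕ × ℕ → Prop) :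
    (∃ q ∈ twoBlocks Q₁ Q₂ Xs ps, q.info.1 < 2 ∧ P q.info.2) ↔ ∃ p ∈ ps, P p := by
  simp only [twoBlocks, List.mem_append, List.mem_map]
  constructor
  · rintro ⟨q, ⟨X, -, rfl⟩ | ⟨p, hp, rfl⟩, h, hP⟩
    · simp [Quantification.info] at h
    · exact ⟨p, hp, hP⟩
  · rintro ⟨p, hp, hP⟩
    exact ⟨_, Or.inr ⟨p, hp, rfl⟩, Q₂.num_lt, hP⟩

theorem exists_mem_twoBlocks_set (P : ℕ → Prop) :
    (∃ q ∈ twoBlocks Q₁ Q₂ Xs ps, 2 ≤ q.info.1 ∧ P q.info.2.2) ↔ ∃ X ∈ Xs, P X := by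
  simp only [twoBlocks, List.mem_append, List.mem_map]
  constructor
  · rintro ⟨q, ⟨X, hX, rfl⟩ | ⟨p, hp, rfl⟩, h, hP⟩
    · exact ⟨X, hX, hP⟩
    · exact absurd Q₂.num_lt (not_lt.2 h)
  · rintro ⟨X, hX, hP⟩
    exact ⟨_, Or.inl ⟨X, hX, rfl⟩, by simp [Quantification.info], hP⟩

theorem isBound_twoBlocks {π : ℕ} :
    IsBound (twoBlocks Q₁ Q₂ Xs ps) π ↔ ∃ p ∈ ps, p.1 = π := by
  rw [IsBound, exists_infoAt_iff _ fun i => i.1 < 2 ∧ i.2.1 = π]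
  exact exists_mem_twoBlocks_trace fun p => p.1 = π

theorem avoidsSets_twoBlocks :
    AvoidsSets (twoBlocks Q₁ Q₂ Xs ps) ↔ ∀ p ∈ ps, p.2 ∉ Xs := by
  have h := exists_mem_twoBlocks_trace (Q₁ := Q₁) (Q₂ := Q₂) (Xs := Xs) (ps := ps)
    fun p => p.2 ∈ Xs
  have h2 : ∀ x : ℕ, (∃ k < (twoBlocks Q₁ Q₂ Xs ps).length,
      2 ≤ (infoAt (twoBlocks Q₁ Q₂ Xs ps) k).1 ∧ (infoAt (twoBlocks Q₁ Q₂ Xs ps) k).2.2 = x) ↔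
      x ∈ Xs := by
    intro x
    rw [exists_infoAt_iff _ fun i => 2 ≤ i.1 ∧ i.2.2 = x, exists_mem_twoBlocks_set fun X => X = x]
    simp
  rw [← exists_infoAt_iff _ fun i => i.1 < 2 ∧ i.2.2 ∈ Xs] at h
  rw [← not_iff_not]
  simp only [← h2] at h ⊢
  unfold AvoidsSets
  push Not
  exact h

theorem IsScoped.twoBlocks (h : IsScoped (twoBlocks Q₁ Q₂ Xs ps)) :
    ∀ p ∈ ps, p.2 = 0 ∨ p.2 = 1 ∨ p.2 ∈ Xs := by
  intro p hp
  have h' : ∀ q ∈ SoHyperLTL.twoBlocks Q₁ Q₂ Xs ps, q.info.1 < 2 →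
      q.info.2.2 = 0 ∨ q.info.2.2 = 1 ∨ q.info.2.2 ∈ Xs := by
    rw [← forall_infoAt_iff _ fun i => i.1 < 2 → i.2.2 = 0 ∨ i.2.2 = 1 ∨ i.2.2 ∈ Xs]
    intro l hl hk
    rcases h l hl hk with h | h | ⟨k, hk, hk2, hX⟩
    · exact Or.inl h
    · exact Or.inr (Or.inl h)
    · obtain ⟨X, hX', hX''⟩ := (exists_mem_twoBlocks_set (Q₁ := Q₁) (Q₂ := Q₂) (Xs := Xs)
        (ps := ps) fun X => X = (infoAt (SoHyperLTL.twoBlocks Q₁ Q₂ Xs ps) l).2.2).1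
        ((exists_infoAt_iff _ fun i => 2 ≤ i.1 ∧ i.2.2 = _).1 ⟨k, hk.trans hl, hk2, hX⟩)
      exact Or.inr (Or.inr (hX'' ▸ hX'))
  refine h' (.trace Q₂ p.1 p.2) ?_ Q₂.num_lt
  simp only [SoHyperLTL.twoBlocks, List.mem_append, List.mem_map]
  exact Or.inr ⟨p, hp, rfl⟩

/-- The condition `0 ∉ Xs` is there because a set quantifier may rebind the special variable
`sysVar`. -/
theorem isSystemPosition_twoBlocks {j : ℕ} {p : ℕ × ℕ} (hp : ps[j]? = some p) :
    IsSystemPosition (twoBlocks Q₁ Q₂ Xs ps) (Xs.length + j) ↔ p.2 = 0 ∧ 0 ∉ Xs := by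
  have h : infoAt (twoBlocks Q₁ Q₂ Xs ps) (Xs.length + j) = (Q₂.num, p.1, p.2) := by
    have := infoAt_append_right (Xs.map (Quantification.set Q₁))
      (ps.map fun p => .trace Q₂ p.1 p.2) j
    rw [List.length_map] at this
    rw [twoBlocks, this]
    exact infoAt_of_getElem? (q := .trace Q₂ p.1 p.2) (by simp [hp])
  have h0 := exists_mem_twoBlocks_set (Q₁ := Q₁) (Q₂ := Q₂) (Xs := Xs) (ps := ps) fun X => X = 0
  rw [← exists_infoAt_iff _ fun i => 2 ≤ i.1 ∧ i.2.2 = 0] at h0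
  rw [IsSystemPosition, h]
  simp only [Q₂.num_lt, true_and]
  refine and_congr Iff.rfl ?_
  rw [← not_iff_not]
  push Not
  rw [h0]
  simp

theorem not_isSystemPosition_of_lt {l : ℕ} (hl : l < Xs.length) :
    ¬ IsSystemPosition (twoBlocks Q₁ Q₂ Xs ps) l := by
  rintro ⟨h, -⟩
  rw [twoBlocks, infoAt_append_left _ (by simpa using hl),
    infoAt_of_getElem? (q := .set Q₁ Xs[l]) (by simp [hl])] at h
  simp [Quantification.info] at h

theorem lastBinder_twoBlocks (π : ℕ) :
    lastBinder (twoBlocks Q₁ Q₂ Xs ps) π =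
      (bindFrom ps Xs.length (fun _ => none) π).getD (Xs.length + ps.length) := by
  have := lastBinder_eq Q₁ Q₂ Q₂ Xs ps [] π
  simpa [twoBlocks] using this

/-- Only the values of `D` at the variables of `ps` matter, so this serves both extremal choices for
the quantified sets. -/
theorem holds_ex_iff_isSatisfiableFor {M : FinSystem} {ψ : Body} {V : Finset ℕ}
    (hψ : ψ.WellFormed M.AP V) (hV : ∀ π ∈ V, ∃ p ∈ ps, p.1 = π) {D : SetAssignment}
    (hD : ∀ p ∈ ps, ∀ t, t ∈ (D p.2).getD ∅ ↔ t ∈ allTraces M.AP ∧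
      (p.2 = 0 → 0 ∉ Xs → t ∈ M.toTransitionSystem.traces)) :
    Holds M.AP ψ (ps.map fun p => .trace .ex p.1 p.2) (fun _ => none) D ↔
      IsSatisfiableFor M ψ.code (twoBlocks Q₁ Q₂ Xs ps) := by
  have hlen : (twoBlocks Q₁ Q₂ Xs ps).length = Xs.length + ps.length := by simp [twoBlocks]
  have hH := holds_traces_ex (AP := M.AP) (ψ := ψ) (D := D) ps [] Xs.length (fun _ _ => ∅)
    (fun _ => none) (by simp)
  rw [List.append_nil] at hH
  have hbind : ∀ π ∈ V, ∃ j < ps.length,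
      bindFrom ps Xs.length (fun _ => none) π = some (Xs.length + j) := by
    intro π hπ
    obtain ⟨l, hl⟩ := Option.isSome_iff_exists.1
      (isSome_bindFrom (k := Xs.length) (r := fun _ => none) (Or.inl (hV π hπ)))
    rcases bindFrom_eq_some hl with h | h
    · exact ⟨l - Xs.length, by omega, by rw [hl]; congr 1; omega⟩
    · simp at h
  have hcongr : ∀ t t' : ℕ → Trace, (∀ j < ps.length, t (Xs.length + j) = t' (Xs.length + j)) →
      (ψ.Holds (fun π => (bindFrom ps Xs.length (fun _ => none) π).map t) ↔
        ψ.Holds fun π => some (t' (lastBinder (twoBlocks Q₁ Q₂ Xs ps) π))) := by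
    intro t t' h
    refine Body.holds_congr hψ fun π hπ => ?_
    obtain ⟨j, hj, hb⟩ := hbind π hπ
    rw [lastBinder_twoBlocks, hb]
    simp [h j hj]
  change Holds M.AP ψ _ (fun π => Option.map (fun _ _ => ∅) none) D ↔ _ at hH
  simp only [Option.map_none] at hH
  rw [hH, IsSatisfiableFor, JointlySatisfiable, Body.ofCode_code, hlen]
  constructor
  · rintro ⟨t, -, hps, h⟩
    -- The positions of set quantifiers and the extra last position, kept for unbound variables, are
    -- filled with the empty trace. It lies in every `allTraces`, and none of these is a system
    -- position.
    refine ⟨fun l => if Xs.length ≤ l ∧ l < Xs.length + ps.length then t l else fun _ => ∅,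
      fun l hl => ?_, fun f _ _ => (hcongr _ (fun l => if Xs.length ≤ l ∧
        l < Xs.length + ps.length then t l else fun _ => ∅) fun j hj => by simp [hj]).1 h⟩
    beta_reduce
    by_cases hl' : Xs.length ≤ l ∧ l < Xs.length + ps.length
    · obtain ⟨j, rfl⟩ := Nat.exists_eq_add_of_le hl'.1
      have hj : j < ps.length := by omega
      have hj' : ps[j]? = some ps[j] := by simp [hj]
      have := (hD ps[j] (List.getElem_mem hj) _).1 (hps j _ hj')
      rw [if_pos hl', isSystemPosition_twoBlocks hj']
      exact ⟨this.1, fun h => this.2 h.1 h.2⟩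
    · rw [if_neg hl']
      refine ⟨fun i => Finset.empty_subset _, fun hs => absurd hs ?_⟩
      by_cases hl'' : l < Xs.length
      · exact not_isSystemPosition_of_lt hl''
      · rintro ⟨h, -⟩
        rw [infoAt_of_length_le (by omega)] at h
        simp at h
  · rintro ⟨t, ht, h⟩
    refine ⟨fun l => if l < Xs.length then fun _ => ∅ else t l, fun l hl => if_pos hl,
      fun j p hp => ?_, (hcongr _ t fun j hj => by simp).2 (h 0 one_pos trivial)⟩
    obtain ⟨hj, rfl⟩ := List.getElem?_eq_some_iff.1 hp
    beta_reduce
    rw [if_neg (by omega), hD _ (List.getElem_mem hj)]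
    obtain ⟨h1, h2⟩ := ht (Xs.length + j) (by omega)
    exact ⟨h1, fun h3 h4 => h2 ((isSystemPosition_twoBlocks hp).2 ⟨h3, h4⟩)⟩

theorem mem_setAll_initialSets {M : FinSystem} {U : Set Trace} {Y : ℕ}
    (hY : Y = 0 ∨ Y = 1 ∨ Y ∈ Xs) (hU : Y ∈ Xs → U = allTraces M.AP) (t : Trace) :
    t ∈ (setAll Xs U (initialSets M.AP M.toTransitionSystem.traces) Y).getD ∅ ↔
      t ∈ allTraces M.AP ∧ (Y = 0 → 0 ∉ Xs → t ∈ M.toTransitionSystem.traces) := by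
  by_cases hX : Y ∈ Xs
  · simp only [setAll, hX, if_true, hU hX, Option.getD_some]
    refine ⟨fun h => ⟨h, ?_⟩, fun h => h.1⟩
    rintro rfl h0
    exact absurd hX h0
  · rcases hY with rfl | rfl | hY
    · have := fun h => M.traces_subset (a := t) h
      simp only [setAll, hX, initialSets, sysVar, allVar]
      simp
      tauto
    · simp [setAll, hX, initialSets, allVar]
    · exact absurd hY hX

theorem holds_setAll_allTraces_iff {M : FinSystem} {ψ : Body} {V : Finset ℕ}
    (hψ : ψ.WellFormed M.AP V) (hV : ∀ π, π ∈ V ↔ IsBound (twoBlocks Q₁ Q₂ Xs ps) π)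
    (hs : IsScoped (twoBlocks Q₁ Q₂ Xs ps)) :
    Holds M.AP ψ (ps.map fun p => .trace .ex p.1 p.2) (fun _ => none)
        (setAll Xs (allTraces M.AP) (initialSets M.AP M.toTransitionSystem.traces)) ↔
      IsSatisfiableFor M ψ.code (twoBlocks Q₁ Q₂ Xs ps) :=
  holds_ex_iff_isSatisfiableFor hψ (fun π hπ => isBound_twoBlocks.1 ((hV π).1 hπ))
    fun p hp t => mem_setAll_initialSets (hs.twoBlocks p hp) (fun _ => rfl) t

/-- If some trace ranges over a quantified set, now empty, the formula is false. Otherwise the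
quantified sets are never consulted and the same satisfiability criterion applies. -/
theorem holds_setAll_empty_iff {M : FinSystem} {ψ : Body} {V : Finset ℕ}
    (hψ : ψ.WellFormed M.AP V) (hV : ∀ π, π ∈ V ↔ IsBound (twoBlocks Q₁ Q₂ Xs ps) π)
    (hs : IsScoped (twoBlocks Q₁ Q₂ Xs ps)) :
    Holds M.AP ψ (ps.map fun p => .trace .ex p.1 p.2) (fun _ => none)
        (setAll Xs ∅ (initialSets M.AP M.toTransitionSystem.traces)) ↔
      AvoidsSets (twoBlocks Q₁ Q₂ Xs ps) ∧
        IsSatisfiableFor M ψ.code (twoBlocks Q₁ Q₂ Xs ps) := by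
  by_cases ha : ∀ p ∈ ps, p.2 ∉ Xs
  · rw [avoidsSets_twoBlocks, and_iff_right ha]
    exact holds_ex_iff_isSatisfiableFor hψ (fun π hπ => isBound_twoBlocks.1 ((hV π).1 hπ))
      fun p hp t => mem_setAll_initialSets (hs.twoBlocks p hp) (fun h => absurd h (ha p hp)) t
  · rw [avoidsSets_twoBlocks]
    refine iff_of_false (fun h => ha fun p hp hX => ?_) fun h => ha h.1
    have hH := holds_traces_ex (AP := M.AP) (ψ := ψ)
      (D := setAll Xs ∅ (initialSets M.AP M.toTransitionSystem.traces)) ps [] 0 (fun _ _ => ∅)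
      (fun _ => none) (by simp)
    rw [List.append_nil] at hH
    obtain ⟨t, -, ht, -⟩ := hH.1 h
    obtain ⟨j, hj⟩ := List.getElem?_of_mem hp
    have := ht j p hj
    simp [setAll, hX] at this

end TwoBlocks

end Criteria

/-! ### The fragment with a single quantified set -/

section SingleSet

/-- A choice function on positions becomes a string of base-`b` digits, so quantifying over choices
is a bounded numerical quantification. -/
theorem exists_digits {b : ℕ} (g : ℕ → ℕ) (hg : ∀ l, g l < b) (n : ℕ) :
    ∃ f < b ^ n, ∀ l < n, f / b ^ l % b = g l := by
  induction n generalizing g with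
  | zero => exact ⟨0, by simp, by simp⟩
  | succ n ih =>
    obtain ⟨f, hf, hd⟩ := ih (fun l => g (l + 1)) fun l => hg _
    have hb : 0 < b := (Nat.zero_le _).trans_lt (hg 0)
    refine ⟨g 0 + b * f, ?_, ?_⟩
    · rw [pow_succ, mul_comm (b ^ n)]
      calc g 0 + b * f < b * (f + 1) := by rw [mul_add]; have := hg 0; omega
        _ ≤ b * b ^ n := Nat.mul_le_mul_left _ hf
    · rintro (_ | l) hl
      · rw [pow_zero, Nat.div_one, Nat.add_mul_mod_self_left, Nat.mod_eq_of_lt (hg 0)]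
      · rw [pow_succ', ← Nat.div_div_eq_div_mul, Nat.add_mul_div_left _ _ hb,
          Nat.div_eq_of_lt (hg 0), Nat.zero_add]
        exact hd l (by omega)

/-- The position of the trace that is read at position `l`, where `f` codes, in base
`qs.length`, a choice of a position for each universal quantification. -/
def resolve (qs : List Quantification) (f l : ℕ) : ℕ :=
  if (infoAt qs l).1 = 1 ∨ qs.length ≤ l then l else f / qs.length ^ l % qs.length

/-- The number `f` codes a choice of an existential for each universal quantification. -/
def IsChoice (qs : List Quantification) (f : ℕ) : Prop :=
  ∀ l < qs.length, (infoAt qs l).1 = 0 →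
    (infoAt qs (f / qs.length ^ l % qs.length)).1 = 1

/-- There are traces for the existential quantifications in `qs` such that the formula with code
`N` holds for all choices of traces for the universal quantifications among these. -/
def IsSatisfiableByChoices (M : FinSystem) (N : ℕ) (qs : List Quantification) : Prop :=
  JointlySatisfiable M N (qs.length + 1) (qs.length ^ qs.length) (fun _ => False) (IsChoice qs)
    fun f π => resolve qs f (lastBinder qs π)

theorem resolve_lt (qs : List Quantification) (f π : ℕ) :
    resolve qs f (lastBinder qs π) < qs.length + 1 := by
  unfold resolve
  split_ifs with h
  · exact lastBinder_lt qs π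
  · push Not at h
    exact (Nat.mod_lt _ (by omega)).trans (Nat.lt_succ_self _)

/-- The list of quantifications of a formula in the fifth fragment. -/
def singleSet (X : ℕ) (πs πs' : List ℕ) : List Quantification :=
  .set .ex X :: (πs.map (fun π => .trace .ex π X) ++ πs'.map (fun π => .trace .all π X))

variable {X : ℕ} {πs πs' : List ℕ}

theorem length_singleSet : (singleSet X πs πs').length = 1 + πs.length + πs'.length := by
  simp [singleSet]
  omega

theorem infoAt_singleSet_ex {j : ℕ} (h : j < πs.length) :
    (infoAt (singleSet X πs πs') (1 + j)).1 = 1 := by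
  rw [singleSet, Nat.add_comm, infoAt_succ, infoAt_append_left _ (by simpa using h),
    infoAt_of_getElem? (q := .trace .ex πs[j] X) (by simp [h])]
  rfl

theorem infoAt_singleSet_all {j : ℕ} (h : j < πs'.length) :
    (infoAt (singleSet X πs πs') (1 + πs.length + j)).1 = 0 := by
  have := infoAt_append_right (πs.map fun π => Quantification.trace .ex π X)
    (πs'.map fun π => .trace .all π X) j
  rw [List.length_map] at this
  rw [singleSet, Nat.add_assoc, Nat.add_comm, infoAt_succ, this,
    infoAt_of_getElem? (q := .trace .all πs'[j] X) (by simp [h])]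
  rfl

theorem infoAt_singleSet_eq_one {l : ℕ} (h : (infoAt (singleSet X πs πs') l).1 = 1) :
    ∃ j < πs.length, l = 1 + j := by
  rcases l with _ | l
  · simp [singleSet, infoAt_zero, Quantification.info, Quant.num] at h
  by_cases h1 : l < πs.length
  · exact ⟨l, h1, Nat.add_comm _ _⟩
  by_cases h2 : l < πs.length + πs'.length
  · have := infoAt_singleSet_all (X := X) (πs := πs) (πs' := πs') (j := l - πs.length) (by omega)
    rw [show 1 + πs.length + (l - πs.length) = l + 1 by omega] at this
    omega
  · rw [infoAt_of_length_le (by rw [length_singleSet]; omega)] at h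
    simp at h

theorem isBound_singleSet {π : ℕ} (h : IsBound (singleSet X πs πs') π) :
    ∃ p ∈ πs.map (·, X) ++ πs'.map (·, X), p.1 = π := by
  rw [IsBound, exists_infoAt_iff _ fun i => i.1 < 2 ∧ i.2.1 = π] at h
  obtain ⟨q, hq, hk, hπ⟩ := h
  simp only [singleSet, List.mem_cons, List.mem_append, List.mem_map] at hq
  rcases hq with rfl | ⟨π', h, rfl⟩ | ⟨π', h, rfl⟩
  · simp [Quantification.info] at hk
  · exact ⟨(π', X), by simp [h], hπ⟩
  · exact ⟨(π', X), by simp [h], hπ⟩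

/-- Shrinking the set to the existential witnesses only weakens the universal part, and then each
universal trace is one of the witnesses. If there are universal quantifiers but no existential ones,
no number is a choice, in accordance with the set being empty. -/
theorem holds_singleSet_iff {M : FinSystem} {ψ : Body} {V : Finset ℕ}
    (hψ : ψ.WellFormed M.AP V) (hV : ∀ π, π ∈ V ↔ IsBound (singleSet X πs πs') π)
    (D : SetAssignment) :
    Holds M.AP ψ (singleSet X πs πs') (fun _ => none) D ↔
      IsSatisfiableByChoices M ψ.code (singleSet X πs πs') := by
  set qs := singleSet X πs πs' with hqs
  set ps : List (ℕ × ℕ) := πs.map (·, X) with hps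
  set ps' : List (ℕ × ℕ) := πs'.map (·, X) with hps'
  have hn : ps.length = πs.length := by simp [hps]
  have hm : ps'.length = πs'.length := by simp [hps']
  have hlen : qs.length = 1 + πs.length + πs'.length := length_singleSet
  have hqs' : qs = [X].map (Quantification.set .ex) ++
      (ps.map (fun p => .trace .ex p.1 p.2) ++ ps'.map (fun p => .trace .all p.1 p.2)) := by
    simp [hqs, hps, hps', singleSet, Function.comp_def]
  have hrange : ∀ π l, bindFrom ps 1 (fun _ => none) π = some l → l < 1 + ps.length := by
    intro π l h
    rcases bindFrom_eq_some h with h | h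
    · exact h.2
    · simp at h
  have hex := fun U => holds_traces_ex (AP := M.AP) (ψ := ψ) (D := Function.update D X (some U))
    ps (ps'.map fun p => .trace .all p.1 p.2) 1 (fun _ _ => ∅) (fun _ => none) (by simp)
  simp only [Option.map_none, holds_traces_all ps' _ _ _ hrange, ← bindFrom_append] at hex
  have hps_mem : ∀ j p, ps[j]? = some p → j < πs.length ∧ p.2 = X := by
    intro j p h
    simp only [hps, List.getElem?_map, Option.map_eq_some_iff] at h
    obtain ⟨π, h, rfl⟩ := h
    exact ⟨(List.getElem?_eq_some_iff.1 h).1, rfl⟩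
  have hps_mem' : ∀ j p, ps'[j]? = some p → j < πs'.length ∧ p.2 = X := by
    intro j p h
    simp only [hps', List.getElem?_map, Option.map_eq_some_iff] at h
    obtain ⟨π, h, rfl⟩ := h
    exact ⟨(List.getElem?_eq_some_iff.1 h).1, rfl⟩
  have hbind : ∀ π ∈ V, ∃ l, bindFrom (ps ++ ps') 1 (fun _ => none) π = some l ∧
      lastBinder qs π = l ∧ 1 ≤ l ∧ l < qs.length := by
    intro π hπ
    obtain ⟨l, hl⟩ := Option.isSome_iff_exists.1 (isSome_bindFrom (k := 1) (r := fun _ => none)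
      (Or.inl (isBound_singleSet ((hV π).1 hπ))))
    refine ⟨l, hl, ?_, ?_⟩
    · rw [hqs', lastBinder_eq]
      simp only [List.length_singleton]
      rw [hl]
      rfl
    · rcases bindFrom_eq_some hl with h | h
      · rw [List.length_append, hn, hm] at h
        omega
      · simp at h
  have hcongr : ∀ (f : ℕ) (t t' : ℕ → Trace),
      (∀ l, 1 ≤ l → l < qs.length → t' l = t (resolve qs f l)) →
      (ψ.Holds (fun π => (bindFrom (ps ++ ps') 1 (fun _ => none) π).map t') ↔
        ψ.Holds fun π => some (t (resolve qs f (lastBinder qs π)))) := by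
    intro f t t' h
    refine Body.holds_congr hψ fun π hπ => ?_
    obtain ⟨l, hb, hl, h1, h2⟩ := hbind π hπ
    rw [hb, hl, Option.map_some, h l h1 h2]
  have hres : ∀ f, ∀ l < qs.length, 1 ≤ l →
      resolve qs f l = if l < 1 + πs.length then l else f / qs.length ^ l % qs.length := by
    intro f l hl h1
    unfold resolve
    by_cases h : l < 1 + πs.length
    · have := infoAt_singleSet_ex (X := X) (πs' := πs') (show l - 1 < πs.length by omega)
      rw [show 1 + (l - 1) = l by omega] at this
      rw [if_pos (Or.inl this), if_pos h]
    · rw [if_neg, if_neg h]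
      rintro (h' | h')
      · obtain ⟨j, hj, rfl⟩ := infoAt_singleSet_eq_one h'
        omega
      · omega
  have hset : Holds M.AP ψ qs (fun _ => none) D ↔ ∃ U ⊆ allTraces M.AP,
      Holds M.AP ψ (ps.map (fun p => .trace .ex p.1 p.2) ++
        ps'.map (fun p => .trace .all p.1 p.2)) (fun _ => none)
          (Function.update D X (some U)) := by
    rw [hqs']
    rfl
  rw [hset]
  simp only [hex]
  rw [IsSatisfiableByChoices, JointlySatisfiable, Body.ofCode_code]
  constructor
  · rintro ⟨U, hU, t, -, htU, h⟩
    have htU' : ∀ l, 1 ≤ l → l < 1 + πs.length → t l ∈ U := by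
      intro l h1 h2
      have := htU (l - 1) (πs[l - 1], X) (by simp [hps, show l - 1 < πs.length by omega])
      rwa [Function.update_self, Option.getD_some, show 1 + (l - 1) = l by omega] at this
    refine ⟨fun l => if 1 ≤ l ∧ l < 1 + πs.length then t l else fun _ => ∅,
      fun l _ => ⟨?_, False.elim⟩, fun f _ hf => ?_⟩
    · beta_reduce
      split_ifs with h'
      · exact hU (htU' l h'.1 h'.2)
      · exact fun i => Finset.empty_subset _
    · have hdig : ∀ l < qs.length, 1 + πs.length ≤ l →
          1 ≤ f / qs.length ^ l % qs.length ∧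
            f / qs.length ^ l % qs.length < 1 + πs.length := by
        intro l hl hl'
        have h0 := infoAt_singleSet_all (X := X) (πs := πs) (πs' := πs')
          (j := l - (1 + πs.length)) (by omega)
        rw [show 1 + πs.length + (l - (1 + πs.length)) = l by omega] at h0
        obtain ⟨j, hj, hj'⟩ := infoAt_singleSet_eq_one (hf l hl h0)
        omega
      -- The universal quantifiers are instantiated with the witnesses that the digits of `f`
      -- select; `hdig` says that they do select existential positions.
      refine (hcongr f (fun l => if 1 ≤ l ∧ l < 1 + πs.length then t l else fun _ => ∅)
        (fun l => if l < 1 + πs.length then t l else t (f / qs.length ^ l % qs.length))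
        fun l h1 h2 => ?_).1 (h _ (fun l hl => ?_) fun j p hp => ?_)
      · rw [hres f l h2 h1]
        by_cases hl : l < 1 + πs.length
        · simp only [if_pos hl, if_pos (And.intro h1 hl)]
        · simp only [if_neg hl, if_pos (hdig l h2 (not_lt.1 hl))]
      · rw [hn] at hl
        exact if_pos hl
      · obtain ⟨hj, hX⟩ := hps_mem' j p hp
        rw [hX, Function.update_self, Option.getD_some, hn, if_neg (by omega)]
        obtain ⟨h1, h2⟩ := hdig (1 + πs.length + j) (by omega) (by omega)
        exact htU' _ h1 h2
  · rintro ⟨t, ht, h⟩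
    -- The set is exactly that of the witnesses; position `0` belongs to the set quantifier.
    refine ⟨{x | ∃ l, 1 ≤ l ∧ l < 1 + πs.length ∧ t l = x}, ?_,
      fun l => if l < 1 then fun _ => ∅ else t l, fun l hl => if_pos hl, fun j p hp => ?_,
      fun t' ht' htU => ?_⟩
    · rintro _ ⟨l, -, hl, rfl⟩
      exact (ht l (by omega)).1
    · obtain ⟨hj, hX⟩ := hps_mem j p hp
      rw [hX, Function.update_self, Option.getD_some]
      beta_reduce
      rw [if_neg (by omega)]
      exact ⟨1 + j, by omega, by omega, rfl⟩
    -- Each universal trace lies in the set, hence is the witness at some position `g`, which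
    -- becomes a digit of `f`. At the other positions the digit is irrelevant.
    · have hg : ∀ l, ∃ g < qs.length, 1 + πs.length ≤ l → l < qs.length →
          1 ≤ g ∧ g < 1 + πs.length ∧ t g = t' l := by
        intro l
        by_cases hl : 1 + πs.length ≤ l ∧ l < qs.length
        · have hj : l - (1 + πs.length) < πs'.length := by omega
          have := htU (l - (1 + πs.length)) (πs'[l - (1 + πs.length)], X) (by simp [hps', hj])
          rw [Function.update_self, Option.getD_some, hn,
            show 1 + πs.length + (l - (1 + πs.length)) = l by omega] at this
          obtain ⟨g, h1, h2, h3⟩ := this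
          exact ⟨g, by omega, fun _ _ => ⟨h1, h2, h3⟩⟩
        · exact ⟨0, by omega, fun h1 h2 => absurd ⟨h1, h2⟩ hl⟩
      choose g hg hg' using hg
      obtain ⟨f, hf, hd⟩ := exists_digits g hg qs.length
      have hf' : IsChoice qs f := by
        intro l hl h0
        rw [hd l hl]
        have hl' : 1 + πs.length ≤ l := by
          by_contra hcon
          rcases l with _ | l
          · simp [hqs, singleSet, infoAt_zero, Quantification.info, Quant.num] at h0
          · have := infoAt_singleSet_ex (X := X) (πs' := πs') (show l < πs.length by omega)
            rw [Nat.add_comm, ← hqs] at this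
            omega
        obtain ⟨h1, h2, -⟩ := hg' l hl' hl
        have := infoAt_singleSet_ex (X := X) (πs' := πs') (show g l - 1 < πs.length by omega)
        rwa [show 1 + (g l - 1) = g l by omega] at this
      refine (hcongr f t t' fun l h1 h2 => ?_).2 (h f hf hf')
      rw [hres f l h2 h1]
      split_ifs with hl
      · rw [ht' l (by omega)]
        exact if_neg (by omega)
      · rw [hd l h2, (hg' l (by omega) h2).2.2]

end SingleSet

/-! ### Recognising the fragments -/

section Recognition

/-- The list of quantifications is that of a formula in one of the first four fragments. -/
def IsTwoBlocks (Q₁ Q₂ : Quant) (qs : List Quantification) : Prop :=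
  ∃ k < qs.length + 1, ∀ l < qs.length,
    (l < k → (infoAt qs l).1 = Q₁.num + 2) ∧ (k ≤ l → (infoAt qs l).1 = Q₂.num)

/-- The list of quantifications is that of a formula in the fifth fragment. -/
def IsSingleSet (qs : List Quantification) : Prop :=
  (infoAt qs 0).1 = Quant.ex.num + 2 ∧ ∃ k < qs.length, ∀ l < qs.length, 0 < l →
    (l < k + 1 → (infoAt qs l).1 = Quant.ex.num ∧ (infoAt qs l).2.2 = (infoAt qs 0).2.2) ∧
    (k + 1 ≤ l → (infoAt qs l).1 = Quant.all.num ∧ (infoAt qs l).2.2 = (infoAt qs 0).2.2)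

/-- A splitting into two blocks amounts to a cut position `k`, over which one can quantify
boundedly. -/
theorem exists_append_iff (qs : List Quantification) (P P' : ℕ × ℕ × ℕ → Prop) :
    (∃ k < qs.length + 1, ∀ l < qs.length,
      (l < k → P (infoAt qs l)) ∧ (k ≤ l → P' (infoAt qs l))) ↔
    ∃ qs₁ qs₂, qs = qs₁ ++ qs₂ ∧ (∀ q ∈ qs₁, P q.info) ∧ ∀ q ∈ qs₂, P' q.info := by
  constructor
  · rintro ⟨k, hk, h⟩
    refine ⟨qs.take k, qs.drop k, (List.take_append_drop k qs).symm, ?_, ?_⟩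
    · rw [← forall_infoAt_iff]
      intro l hl
      rw [List.length_take] at hl
      rw [← infoAt_append_left (qs.drop k) (by rwa [List.length_take]), List.take_append_drop]
      exact (h l (by omega)).1 (by omega)
    · rw [← forall_infoAt_iff]
      intro l hl
      rw [List.length_drop] at hl
      have := infoAt_append_right (qs.take k) (qs.drop k) l
      rw [List.take_append_drop, List.length_take, Nat.min_eq_left (by omega)] at this
      rw [← this]
      exact (h (k + l) (by omega)).2 (by omega)
  · rintro ⟨qs₁, qs₂, rfl, h₁, h₂⟩
    rw [← forall_infoAt_iff] at h₁ h₂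
    refine ⟨qs₁.length, by simp, fun l hl => ⟨fun hk => ?_, fun hk => ?_⟩⟩
    · rw [infoAt_append_left _ hk]
      exact h₁ l hk
    · obtain ⟨j, rfl⟩ := Nat.exists_eq_add_of_le hk
      rw [List.length_append] at hl
      rw [infoAt_append_right]
      exact h₂ j (by omega)

theorem forall_info_eq_set_iff (Q : Quant) (qs : List Quantification) :
    (∀ q ∈ qs, q.info.1 = Q.num + 2) ↔ ∃ Xs : List ℕ, qs = Xs.map fun X => .set Q X := by
  constructor
  · induction qs with
    | nil => exact fun _ => ⟨[], rfl⟩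
    | cons q qs ih =>
      intro h
      obtain ⟨Xs, rfl⟩ := ih fun q hq => h q (List.mem_cons_of_mem _ hq)
      have hq := h q List.mem_cons_self
      cases q with
      | trace Q' π X =>
        have := Q'.num_lt
        simp only [Quantification.info] at hq
        omega
      | set Q' X =>
        have : Q' = Q := Quant.num_injective (by simpa [Quantification.info] using hq)
        exact ⟨X :: Xs, by rw [this]; rfl⟩
  · rintro ⟨Xs, rfl⟩ q hq
    obtain ⟨X, -, rfl⟩ := List.mem_map.1 hq
    rfl

theorem forall_info_eq_trace_iff (Q : Quant) (qs : List Quantification) :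
    (∀ q ∈ qs, q.info.1 = Q.num) ↔
      ∃ ps : List (ℕ × ℕ), qs = ps.map fun p => .trace Q p.1 p.2 := by
  constructor
  · induction qs with
    | nil => exact fun _ => ⟨[], rfl⟩
    | cons q qs ih =>
      intro h
      obtain ⟨ps, rfl⟩ := ih fun q hq => h q (List.mem_cons_of_mem _ hq)
      have hq := h q List.mem_cons_self
      cases q with
      | trace Q' π X =>
        exact ⟨(π, X) :: ps, by rw [Quant.num_injective hq]; rfl⟩
      | set Q' X =>
        have := Q.num_lt
        simp only [Quantification.info] at hq
        omega
  · rintro ⟨Xs, rfl⟩ q hq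
    obtain ⟨X, -, rfl⟩ := List.mem_map.1 hq
    rfl

theorem forall_info_eq_trace_var_iff (Q : Quant) (X : ℕ) (qs : List Quantification) :
    (∀ q ∈ qs, q.info.1 = Q.num ∧ q.info.2.2 = X) ↔
      ∃ πs : List ℕ, qs = πs.map fun π => .trace Q π X := by
  constructor
  · intro h
    obtain ⟨ps, rfl⟩ := (forall_info_eq_trace_iff Q qs).1 fun q hq => (h q hq).1
    refine ⟨ps.map Prod.fst, ?_⟩
    rw [List.map_map]
    refine List.map_congr_left fun p hp => ?_
    have : p.2 = X := (h _ (List.mem_map_of_mem hp)).2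
    rw [← this]
    rfl
  · rintro ⟨πs, rfl⟩ q hq
    obtain ⟨π, -, rfl⟩ := List.mem_map.1 hq
    exact ⟨rfl, rfl⟩

theorem fragment_iff (Q₁ Q₂ : Quant) (φ : Formula) :
    Fragment Q₁ Q₂ φ ↔ IsTwoBlocks Q₁ Q₂ φ.quants := by
  unfold IsTwoBlocks
  rw [exists_append_iff _ (fun i => i.1 = Q₁.num + 2) fun i => i.1 = Q₂.num]
  simp only [forall_info_eq_set_iff, forall_info_eq_trace_iff]
  constructor
  · rintro ⟨Xs, ps, h⟩
    exact ⟨_, _, h, ⟨Xs, rfl⟩, ⟨ps, rfl⟩⟩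
  · rintro ⟨_, _, h, ⟨Xs, rfl⟩, ⟨ps, rfl⟩⟩
    exact ⟨Xs, ps, h⟩

theorem singleSetFragment_iff (φ : Formula) :
    SingleSetFragment φ ↔ IsSingleSet φ.quants := by
  unfold SingleSetFragment IsSingleSet
  rcases φ.quants with _ | ⟨q, qs⟩
  · simp
  have h := exists_append_iff qs
    (fun i => i.1 = Quant.ex.num ∧ i.2.2 = q.info.2.2)
    fun i => i.1 = Quant.all.num ∧ i.2.2 = q.info.2.2
  simp only [forall_info_eq_trace_var_iff] at h
  simp only [List.length_cons, Nat.forall_lt_succ_left, infoAt_zero, infoAt_succ,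
    Nat.add_lt_add_iff_right, Nat.add_le_add_iff_right, lt_self_iff_false, false_imp_iff,
    true_and, Nat.succ_pos, forall_const]
  rw [h]
  constructor
  · rintro ⟨X, πs, πs', h⟩
    obtain ⟨rfl, rfl⟩ := List.cons_eq_cons.1 h
    exact ⟨rfl, _, _, rfl, ⟨πs, rfl⟩, ⟨πs', rfl⟩⟩
  · rintro ⟨hq, _, _, h, ⟨πs, rfl⟩, ⟨πs', rfl⟩⟩
    obtain ⟨Xs, hX⟩ := (forall_info_eq_set_iff .ex [q]).1 (by simpa using hq)
    rcases Xs with _ | ⟨X, Xs⟩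
    · simp at hX
    · have hX := (List.cons_eq_cons.1 hX).1
      subst hX
      exact ⟨X, πs, πs', by rw [h]; rfl⟩

end Recognition

/-! ### Primitive recursiveness of the criteria -/

section PrimitiveRecursion

variable {α : Type} [Primcodable α]

theorem primrec_info : Primrec Quantification.info := by
  have hnum : Primrec Quant.num := by
    have : Primrec fun Q => (Quant.equivBool Q).toNat :=
      (Primrec.dom_bool Bool.toNat).comp Primrec.of_equiv
    exact this.of_eq fun Q => by cases Q <;> rfl
  have h : Primrec fun q : Quantification => Sum.casesOn (motive := fun _ => ℕ × ℕ × ℕ)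
      (Quantification.equivSum q) (fun a => (a.1.num, a.2.1, a.2.2))
      fun b => (b.1.num + 2, 0, b.2) := by
    refine Primrec.sumCasesOn Primrec.of_equiv ?_ ?_
    · exact ((hnum.comp (by fun_prop)).pair (by fun_prop) :
        Primrec fun x : Quantification × Quant × ℕ × ℕ => (x.2.1.num, x.2.2.1, x.2.2.2))
    · have hn : Primrec fun x : Quantification × Quant × ℕ => x.2.1.num :=
        hnum.comp (by fun_prop)
      exact (by fun_prop : Primrec fun x : Quantification × Quant × ℕ =>
        (x.2.1.num + 2, 0, x.2.2))
  exact h.of_eq fun q => by cases q <;> rfl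

@[fun_prop]
theorem primrec_infoAt {f : α → List Quantification} {g : α → ℕ} (hf : Primrec f)
    (hg : Primrec g) : Primrec fun a => infoAt (f a) (g a) := by
  have h : Primrec fun a => ((f a)[g a]?).map Quantification.info :=
    Primrec.option_map (Primrec.list_getElem?.comp hf hg) (primrec_info.comp Primrec.snd)
  exact Primrec.option_getD.comp h (Primrec.const _)

@[fun_prop]
theorem primrec_length {β : Type} [Primcodable β] {f : α → List β} (hf : Primrec f) :
    Primrec fun a => (f a).length := Primrec.list_length.comp hf

@[fun_prop]
theorem primrec_lastBinder {f : α → List Quantification} {g : α → ℕ} (hf : Primrec f)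
    (hg : Primrec g) : Primrec fun a => lastBinder (f a) (g a) := by
  have hi : Primrec fun x : α × (ℕ × ℕ) × Quantification => x.2.2.info :=
    primrec_info.comp (by fun_prop)
  have hc : PrimrecPred fun x : α × (ℕ × ℕ) × Quantification =>
      x.2.2.info.1 < 2 ∧ x.2.2.info.2.1 = g x.1 :=
    primrecPred_and (primrecPred_lt (by fun_prop) (by fun_prop))
      (primrecPred_eq (by fun_prop) (by fun_prop))
  have hite := Primrec.ite hc (f := fun x : α × (ℕ × ℕ) × Quantification => x.2.1.1)
    (g := fun x => x.2.1.2) (by fun_prop) (by fun_prop)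
  have hstep : Primrec fun x : α × (ℕ × ℕ) × Quantification => x.2.1.1 + 1 := by fun_prop
  exact Primrec.snd.comp (Primrec.list_foldl (h := fun (a : α) (x : (ℕ × ℕ) × Quantification) =>
    (x.1.1 + 1, if x.2.info.1 < 2 ∧ x.2.info.2.1 = g a then x.1.1 else x.1.2)) hf
    (by fun_prop : Primrec fun a => (0, (f a).length)) (hstep.pair hite))

@[fun_prop]
theorem primrec_resolve {f : α → List Quantification} {g h : α → ℕ} (hf : Primrec f)
    (hg : Primrec g) (hh : Primrec h) : Primrec fun a => resolve (f a) (g a) (h a) := by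
  unfold resolve
  exact Primrec.ite (primrecPred_or (primrecPred_eq (by fun_prop) (by fun_prop))
    (primrecPred_le (by fun_prop) (by fun_prop))) (by fun_prop) (by fun_prop)

@[fun_prop]
theorem primrec_quants {f : α → Formula} (hf : Primrec f) : Primrec fun a => (f a).quants :=
  have h : Primrec fun a => Formula.equivProd (f a) := Primrec.of_equiv.comp hf
  Primrec.fst.comp h

@[fun_prop]
theorem primrec_body_code {f : α → Formula} (hf : Primrec f) :
    Primrec fun a => (f a).body.code :=
  have h : Primrec fun a => Formula.equivProd (f a) := Primrec.of_equiv.comp hf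
  Primrec.encode.comp (Primrec.snd.comp h)

variable {M : α → FinSystem} {N : α → ℕ} {qs : α → List Quantification}

theorem primrecPred_isBound {π : α → ℕ} (hqs : Primrec qs) (hπ : Primrec π) :
    PrimrecPred fun a => IsBound (qs a) (π a) :=
  primrecPred_exists_lt (by fun_prop) (primrecPred_and
    (primrecPred_lt (by fun_prop) (by fun_prop)) (primrecPred_eq (by fun_prop) (by fun_prop)))

theorem primrecPred_isScoped (hqs : Primrec qs) : PrimrecPred fun a => IsScoped (qs a) :=
  primrecPred_forall_lt (by fun_prop) (primrecPred_imp
    (primrecPred_lt (by fun_prop) (by fun_prop)) (primrecPred_or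
      (primrecPred_eq (by fun_prop) (by fun_prop)) (primrecPred_or
        (primrecPred_eq (by fun_prop) (by fun_prop))
        (primrecPred_exists_lt (by fun_prop) (primrecPred_and
          (primrecPred_le (by fun_prop) (by fun_prop))
          (primrecPred_eq (by fun_prop) (by fun_prop)))))))

theorem primrecPred_isSystemPosition {l : α → ℕ} (hqs : Primrec qs) (hl : Primrec l) :
    PrimrecPred fun a => IsSystemPosition (qs a) (l a) :=
  primrecPred_and (primrecPred_lt (by fun_prop) (by fun_prop)) (primrecPred_and
    (primrecPred_eq (by fun_prop) (by fun_prop)) (primrecPred_forall_lt (by fun_prop)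
      (primrecPred_imp (primrecPred_le (by fun_prop) (by fun_prop))
        (primrecPred_not (primrecPred_eq (by fun_prop) (by fun_prop))))))

theorem primrecPred_avoidsSets (hqs : Primrec qs) : PrimrecPred fun a => AvoidsSets (qs a) :=
  primrecPred_forall_lt (by fun_prop) (primrecPred_imp
    (primrecPred_lt (by fun_prop) (by fun_prop)) (primrecPred_forall_lt (by fun_prop)
      (primrecPred_imp (primrecPred_le (by fun_prop) (by fun_prop))
        (primrecPred_not (primrecPred_eq (by fun_prop) (by fun_prop))))))

theorem primrecPred_isTwoBlocks (Q₁ Q₂ : Quant) (hqs : Primrec qs) :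
    PrimrecPred fun a => IsTwoBlocks Q₁ Q₂ (qs a) :=
  primrecPred_exists_lt (by fun_prop) (primrecPred_forall_lt (by fun_prop) (primrecPred_and
    (primrecPred_imp (primrecPred_lt (by fun_prop) (by fun_prop))
      (primrecPred_eq (by fun_prop) (by fun_prop)))
    (primrecPred_imp (primrecPred_le (by fun_prop) (by fun_prop))
      (primrecPred_eq (by fun_prop) (by fun_prop)))))

theorem primrecPred_isSingleSet (hqs : Primrec qs) : PrimrecPred fun a => IsSingleSet (qs a) :=
  primrecPred_and (primrecPred_eq (by fun_prop) (by fun_prop))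
    (primrecPred_exists_lt (by fun_prop) (primrecPred_forall_lt (by fun_prop)
      (primrecPred_imp (primrecPred_lt (by fun_prop) (by fun_prop)) (primrecPred_and
        (primrecPred_imp (primrecPred_lt (by fun_prop) (by fun_prop)) (primrecPred_and
          (primrecPred_eq (by fun_prop) (by fun_prop))
          (primrecPred_eq (by fun_prop) (by fun_prop))))
        (primrecPred_imp (primrecPred_le (by fun_prop) (by fun_prop)) (primrecPred_and
          (primrecPred_eq (by fun_prop) (by fun_prop))
          (primrecPred_eq (by fun_prop) (by fun_prop))))))))

theorem primrecPred_isChoice {f : α → ℕ} (hqs : Primrec qs) (hf : Primrec f) :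
    PrimrecPred fun a => IsChoice (qs a) (f a) :=
  primrecPred_forall_lt (by fun_prop) (primrecPred_imp
    (primrecPred_eq (by fun_prop) (by fun_prop)) (primrecPred_eq (by fun_prop) (by fun_prop)))

theorem primrecPred_isGoodBody (hM : Primrec M) (hN : Primrec N) (hqs : Primrec qs) :
    PrimrecPred fun a => IsGoodBody (M a).props (N a) (IsBound (qs a)) := by
  refine primrecPred_exists_lt (by fun_prop) (primrecPred_and
    (primrecPred_testBit (by fun_prop) (by fun_prop)) (primrecPred_forall_lt (by fun_prop)
      (primrecPred_imp (primrecPred_testBit (by fun_prop) (by fun_prop))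
        (primrecPred_and (primrecPred_imp (primrecPred_eq (by fun_prop) (by fun_prop))
          (primrecPred_and (primrecPred_mem (by fun_prop) (by fun_prop))
            (primrecPred_isBound (by fun_prop) (by fun_prop))))
        (primrecPred_and (primrecPred_imp (primrecPred_or
          (primrecPred_eq (by fun_prop) (by fun_prop))
          (primrecPred_eq (by fun_prop) (by fun_prop)))
          (primrecPred_testBit (by fun_prop) (by fun_prop)))
        (primrecPred_imp (primrecPred_lt (by fun_prop) (by fun_prop)) (primrecPred_and
          (primrecPred_testBit (by fun_prop) (by fun_prop))
          (primrecPred_testBit (by fun_prop) (by fun_prop)))))))))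

theorem primrecPred_isSatisfiableFor (hM : Primrec M) (hN : Primrec N) (hqs : Primrec qs) :
    PrimrecPred fun a => IsSatisfiableFor (M a) (N a) (qs a) :=
  primrecPred_jointlySatisfiable (fun _ _ _ => lastBinder_lt _ _) hM hN (by fun_prop)
    (by fun_prop) (primrecPred_isSystemPosition (by fun_prop) (by fun_prop))
    (primrecPred_eq (Primrec.const 0) (Primrec.const 0) |>.of_eq fun _ => by simp)
    (by fun_prop)

theorem primrecPred_isSatisfiableByChoices (hM : Primrec M) (hN : Primrec N)
    (hqs : Primrec qs) : PrimrecPred fun a => IsSatisfiableByChoices (M a) (N a) (qs a) :=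
  primrecPred_jointlySatisfiable (fun _ _ _ => resolve_lt _ _ _) hM hN (by fun_prop)
    (by fun_prop)
    (primrecPred_eq (Primrec.const 0) (Primrec.const 1) |>.of_eq fun _ => by simp)
    (primrecPred_isChoice (by fun_prop) (by fun_prop)) (by fun_prop)

end PrimitiveRecursion

/-! ### Decidability for the five fragments -/

/-- Fragment and well-formedness are tested separately, so the criterion `C` has to be correct only
on well-formed formulas of the fragment. -/
theorem modelCheckingDecidable_of_iff {F : Formula → Prop} {F' : List Quantification → Prop}
    {C : FinSystem × Formula → Prop} (hF : ∀ φ, F φ ↔ F' φ.quants)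
    (hF' : PrimrecPred fun x : FinSystem × Formula => F' x.2.quants) (hC : PrimrecPred C)
    (h : ∀ M φ V, F φ → IsScoped φ.quants → (∀ π, π ∈ V ↔ IsBound φ.quants π) →
      φ.body.WellFormed M.AP V →
      (Holds M.AP φ.body φ.quants (fun _ => none)
        (initialSets M.AP M.toTransitionSystem.traces) ↔ C (M, φ))) :
    ModelCheckingDecidable F := by
  have hp : PrimrecPred fun x : FinSystem × Formula => F' x.2.quants ∧
      (IsScoped x.2.quants ∧ IsGoodBody x.1.props x.2.body.code (IsBound x.2.quants)) ∧ C x :=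
    primrecPred_and hF' (primrecPred_and (primrecPred_and
      (primrecPred_isScoped (by fun_prop))
      (primrecPred_isGoodBody (by fun_prop) (by fun_prop) (by fun_prop))) hC)
  refine hp.computablePred.of_eq fun ⟨M, φ⟩ => ?_
  rw [← hF, ← Formula.wellFormed_iff]
  refine and_congr_right fun hFφ => and_congr_right fun hw => ?_
  obtain ⟨V, hV⟩ := exists_finset_isBound φ.quants
  rw [Formula.wellFormed_iff_of_isBound _ _ hV] at hw
  exact (h M φ V hFφ hw.1 hV hw.2).symm

theorem modelCheckingDecidable_ex_all : ModelCheckingDecidable (Fragment .ex .all) := by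
  -- `5 * x.2.body.code + 1` is the code of the negated body.
  refine modelCheckingDecidable_of_iff (C := fun x => ¬ (AvoidsSets x.2.quants ∧
      IsSatisfiableFor x.1 (5 * x.2.body.code + 1) x.2.quants)) (fragment_iff _ _)
    (primrecPred_isTwoBlocks _ _ (by fun_prop))
    (primrecPred_not (primrecPred_and (primrecPred_avoidsSets (by fun_prop))
      (primrecPred_isSatisfiableFor (by fun_prop) (by fun_prop) (by fun_prop)))) ?_
  rintro M ⟨_, ψ⟩ V ⟨Xs, ps, rfl⟩ hs hV hψ
  exact (holds_ex_all Xs ps).trans (not_congr (holds_setAll_empty_iff (ψ := ψ.neg) hψ hV hs))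

theorem modelCheckingDecidable_all_all : ModelCheckingDecidable (Fragment .all .all) := by
  refine modelCheckingDecidable_of_iff (C := fun x => ¬
      IsSatisfiableFor x.1 (5 * x.2.body.code + 1) x.2.quants) (fragment_iff _ _)
    (primrecPred_isTwoBlocks _ _ (by fun_prop))
    (primrecPred_not
      (primrecPred_isSatisfiableFor (by fun_prop) (by fun_prop) (by fun_prop))) ?_
  rintro M ⟨_, ψ⟩ V ⟨Xs, ps, rfl⟩ hs hV hψ
  exact (holds_all_all Xs ps).trans
    (not_congr (holds_setAll_allTraces_iff (ψ := ψ.neg) hψ hV hs))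

theorem modelCheckingDecidable_ex_ex : ModelCheckingDecidable (Fragment .ex .ex) := by
  refine modelCheckingDecidable_of_iff (C := fun x =>
      IsSatisfiableFor x.1 x.2.body.code x.2.quants) (fragment_iff _ _)
    (primrecPred_isTwoBlocks _ _ (by fun_prop))
    (primrecPred_isSatisfiableFor (by fun_prop) (by fun_prop) (by fun_prop)) ?_
  rintro M ⟨_, ψ⟩ V ⟨Xs, ps, rfl⟩ hs hV hψ
  exact (holds_ex_ex Xs ps).trans (holds_setAll_allTraces_iff hψ hV hs)

theorem modelCheckingDecidable_all_ex : ModelCheckingDecidable (Fragment .all .ex) := by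
  refine modelCheckingDecidable_of_iff (C := fun x => AvoidsSets x.2.quants ∧
      IsSatisfiableFor x.1 x.2.body.code x.2.quants) (fragment_iff _ _)
    (primrecPred_isTwoBlocks _ _ (by fun_prop))
    (primrecPred_and (primrecPred_avoidsSets (by fun_prop))
      (primrecPred_isSatisfiableFor (by fun_prop) (by fun_prop) (by fun_prop))) ?_
  rintro M ⟨_, ψ⟩ V ⟨Xs, ps, rfl⟩ hs hV hψ
  exact (holds_all_ex Xs ps).trans (holds_setAll_empty_iff hψ hV hs)

theorem modelCheckingDecidable_singleSet : ModelCheckingDecidable SingleSetFragment := by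
  refine modelCheckingDecidable_of_iff (C := fun x =>
      IsSatisfiableByChoices x.1 x.2.body.code x.2.quants) singleSetFragment_iff
    (primrecPred_isSingleSet (by fun_prop))
    (primrecPred_isSatisfiableByChoices (by fun_prop) (by fun_prop) (by fun_prop)) ?_
  rintro M ⟨_, ψ⟩ V ⟨X, πs, πs', rfl⟩ hs hV hψ
  exact holds_singleSet_iff hψ hV _

end SoHyperLTL

theorem mainTheorem6 :
    SoHyperLTL.ModelCheckingDecidable (SoHyperLTL.Fragment .ex .all) ∧
    SoHyperLTL.ModelCheckingDecidable (SoHyperLTL.Fragment .all .all) ∧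
    SoHyperLTL.ModelCheckingDecidable (SoHyperLTL.Fragment .ex .ex) ∧
    SoHyperLTL.ModelCheckingDecidable (SoHyperLTL.Fragment .all .ex) ∧
    SoHyperLTL.ModelCheckingDecidable SoHyperLTL.SingleSetFragment :=
  ⟨SoHyperLTL.modelCheckingDecidable_ex_all, SoHyperLTL.modelCheckingDecidable_all_all,
    SoHyperLTL.modelCheckingDecidable_ex_ex, SoHyperLTL.modelCheckingDecidable_all_ex,
    SoHyperLTL.modelCheckingDecidable_singleSet⟩
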